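/- Let $n\ge 0$ and let $B_n$ be the group of signed permutations, i.e. the bijections $w$ of $\{\pm1,\dots,\pm n\}$ with $w(-i)=-w(i)$. A signed cycle of $x\in B_n$ is either positive, namely $c\cup(-c)$ for two disjoint opposite cycles $c,-c$ of the permutation $x$, each of length $i$, or negative, namely one cycle $c=-c$ of $x$, of length $2i$; in both cases its length as a signed cycle is $i$. If $x$ has $a_{i,\varepsilon}$ signed cycles of length $i$ and sign $\varepsilon\in\{+,-\}$, its centralizer is $$Z_x\cong\prod_{i\ge1}\bigl(G_{i,+}\wr S_{a_{i,+}}\times G_{i,-}\wr S_{a_{i,-}}\bigr),$$ where $G_{i,+}\cong\mathbb Z_2\times\mathbb Z_i$ (with $\mathbb Z_2$ generated by the negation $-1$ and $\mathbb Z_i$ by the cycle) and $G_{i,-}\cong\mathbb Z_{2i}$ (generated by the cycle) are the centralizers in $B_i$ of a single signed cycle of length $i$ and the given sign. Let $\omega^x$ be the linear character of $Z_x$ which, on $G_{i,+}\wr S_{a_{i,+}}$, equals the trivial character on each factor $\mathbb Z_2$, a fixed primitive (faithful) linear character on each factor $\mathbb Z_i$, and is trivial on $S_{a_{i,+}}$,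 and which, on $G_{i,-}\wr S_{a_{i,-}}$, equals a fixed primitive linear character on each factor $\mathbb Z_{2i}$ and is trivial on $S_{a_{i,-}}$. For a conjugacy class $C$ of $B_n$ choose $x\in C$ and let the higher Lie character $\psi^C$ be the character of $B_n$ induced from $\omega^x$. Then, for every integer $k$ and every $n\ge0$, and for all choices of the elements $x\in C$, of the primitive characters and of the wreathing subgroups (given by a base point on each signed cycle), the root enumerator $\mathrm{r}_k^{B_n}(g)=|\{h\in B_n : h^k=g\}|$ satisfies $$\mathrm{r}_k^{B_n}=\sum_{C\,:\,C^k=\{1\}}\psi^C ,$$ where $C$ runs over the conjugacy classes of $B_n$ and $C^k=\{y^k : y\in C\}$. -/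

import Mathlib

noncomputable section

/-! ### Root enumerators and induced characters of finite groups -/

/-- The `k`-th root enumerator of a group: the number of `h` with `h ^ k = g` (`k` any integer). -/
def rootEnum {G : Type*} [Group G] (k : ℤ) (g : G) : ℕ :=
  Nat.card {h : G // h ^ k = g}

open Classical in
/-- The character of the finite group `G` induced from a linear character `χ` of a subgroup `H`:
`g ↦ (1 / |H|) * ∑ a, χ⁰ (a⁻¹ g a)`, where `χ⁰` extends `χ` by zero outside `H`. -/
def inducedCharacter {G : Type*} [Group G] [Fintype G] (H : Subgroup G) (χ : H →* ℂˣ) (g : G) : ℂ :=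
  (Nat.card H : ℂ)⁻¹ *
    ∑ a : G, if h : a⁻¹ * g * a ∈ H then ((χ ⟨a⁻¹ * g * a, h⟩ : ℂˣ) : ℂ) else 0

namespace SignedPerm

/-! ### The hyperoctahedral group -/

/-- The set `{±1, …, ±n}`: the pair `(i, s)` stands for the number `s * (i + 1)`. -/
abbrev Pt (n : ℕ) : Type := Fin n × ℤˣ

/-- The negation `p ↦ -p` of `{±1, …, ±n}`. -/
def negPt {n : ℕ} (p : Pt n) : Pt n := (p.1, -p.2)

theorem negPt_negPt {n : ℕ} (p : Pt n) : negPt (negPt p) = p := by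
  simp [negPt]

theorem negPt_ne {n : ℕ} (p : Pt n) : negPt p ≠ p := by
  intro h
  have h2 : -p.2 = p.2 := congrArg Prod.snd h
  rcases Int.units_eq_one_or p.2 with h1 | h1 <;> rw [h1] at h2 <;> revert h2 <;> decide

/-- The group of signed permutations: the bijections `w` of `{±1, …, ±n}` with
`w (-p) = - w p`, under composition. -/
def hyperoctahedral (n : ℕ) : Subgroup (Equiv.Perm (Pt n)) where
  carrier := {w | ∀ p, w (negPt p) = negPt (w p)}
  one_mem' := fun _ => rfl
  mul_mem' := by
    intro a b ha hb p
    change a (b (negPt p)) = negPt (a (b p))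
    rw [show b (negPt p) = negPt (b p) from hb p, show a (negPt (b p)) = _ from ha (b p)]
  inv_mem' := by
    intro a ha p
    rw [Equiv.Perm.inv_eq_iff_eq, show a (negPt (a⁻¹ p)) = _ from ha (a⁻¹ p)]
    simp

/-- The Weyl group `B_n`. -/
abbrev B (n : ℕ) : Type := hyperoctahedral n

instance instFintypeB (n : ℕ) : Fintype (B n) := Fintype.ofFinite _

variable {n : ℕ}

/-- The action of a signed permutation on `{±1, …, ±n}`. -/
def act (w : B n) (p : Pt n) : Pt n := (w : Equiv.Perm (Pt n)) p

theorem act_mul (v w : B n) (p : Pt n) : act (v * w) p = act v (act w p) := rfl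

theorem act_one (p : Pt n) : act (1 : B n) p = p := rfl

theorem act_neg (w : B n) (p : Pt n) : act w (negPt p) = negPt (act w p) := w.2 p

theorem act_inj (w : B n) {p q : Pt n} : act w p = act w q ↔ p = q :=
  (w : Equiv.Perm (Pt n)).injective.eq_iff

/-! ### Signed cycles -/

/-- Two points lie on the same signed cycle of `x` if, up to sign, some power of `x` carries
one to the other. -/
def cycleSetoid (x : B n) : Setoid (Pt n) where
  r p q := ∃ m : ℤ, q = act (x ^ m) p ∨ q = negPt (act (x ^ m) p)
  iseqv :=
    { refl := fun p => ⟨0, Or.inl (by rw [zpow_zero, act_one])⟩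
      symm := by
        rintro p q ⟨m, rfl | rfl⟩
        · exact ⟨-m, Or.inl (by rw [← act_mul, ← zpow_add, neg_add_cancel, zpow_zero, act_one])⟩
        · exact ⟨-m, Or.inr (by
            rw [act_neg, negPt_negPt, ← act_mul, ← zpow_add, neg_add_cancel, zpow_zero, act_one])⟩
      trans := by
        rintro p q r ⟨m, rfl | rfl⟩ ⟨l, rfl | rfl⟩
        · exact ⟨l + m, Or.inl (by rw [zpow_add, act_mul])⟩
        · exact ⟨l + m, Or.inr (by rw [zpow_add, act_mul])⟩
        · exact ⟨l + m, Or.inr (by rw [zpow_add, act_mul, act_neg])⟩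
        · exact ⟨l + m, Or.inl (by rw [zpow_add, act_mul, act_neg, negPt_negPt])⟩ }

/-- The signed cycles of `x`: the orbits on `{±1, …, ±n}` of the group generated by `x` and
the negation. As a set of points, a signed cycle is either `c ∪ (-c)` for a pair of disjoint
opposite cycles `c`, `-c` of the permutation `x`, or a single cycle `c = -c`. -/
def SCycle (x : B n) : Type := Quotient (cycleSetoid x)

instance (x : B n) : Finite (SCycle x) := by unfold SCycle; infer_instance

instance (x : B n) : Fintype (SCycle x) := Fintype.ofFinite _

/-- The signed cycle of `x` through `p`. -/
def cycleOf (x : B n) (p : Pt n) : SCycle x := Quotient.mk (cycleSetoid x) p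

theorem cycleOf_eq {x : B n} {p q : Pt n} :
    cycleOf x p = cycleOf x q ↔ ∃ m : ℤ, q = act (x ^ m) p ∨ q = negPt (act (x ^ m) p) :=
  Quotient.eq (r := cycleSetoid x)

/-- The signed cycle of `x` through `p` is negative: the cycle of the permutation `x`
through `p` contains `-p`. Otherwise it is positive. -/
def IsNegAt (x : B n) (p : Pt n) : Prop := ∃ m : ℤ, negPt p = act (x ^ m) p

open Classical in
/-- The length of the signed cycle of `x` through `p`: if `ℓ` is the length of the cycle of the
permutation `x` of `{±1, …, ±n}` through `p`, it is `ℓ` for a positive cycle and `ℓ / 2` for a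
negative one. -/
def cycleLength (x : B n) (p : Pt n) : ℕ :=
  if IsNegAt x p then Function.minimalPeriod (act x) p / 2 else Function.minimalPeriod (act x) p

theorem act_zpow_eq_iff (x : B n) (p : Pt n) (m : ℤ) :
    act (x ^ m) p = p ↔ ((Function.minimalPeriod (act x) p : ℕ) : ℤ) ∣ m :=
  MulAction.zpow_smul_eq_iff_minimalPeriod_dvd (a := x) (b := p) (n := m)

theorem act_zpow_comm {x v : B n} (hv : Commute v x) (m : ℤ) (p : Pt n) :
    act (x ^ m) (act v p) = act v (act (x ^ m) p) := by
  rw [← act_mul, ← act_mul, (hv.zpow_right m).eq]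

theorem isNegAt_act {x v : B n} (hv : Commute v x) (p : Pt n) :
    IsNegAt x (act v p) ↔ IsNegAt x p := by
  simp only [IsNegAt, act_zpow_comm hv, ← act_neg, act_inj]

theorem isNegAt_neg (x : B n) (p : Pt n) : IsNegAt x (negPt p) ↔ IsNegAt x p := by
  have h : ∀ p : Pt n, IsNegAt x p → IsNegAt x (negPt p) := by
    rintro p ⟨m, hm⟩
    exact ⟨m, by rw [act_neg, ← hm]⟩
  exact ⟨fun hp => negPt_negPt p ▸ h _ hp, h p⟩

theorem minimalPeriod_act {x v : B n} (hv : Commute v x) (p : Pt n) :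
    Function.minimalPeriod (act x) (act v p) = Function.minimalPeriod (act x) p := by
  apply Nat.dvd_antisymm <;> rw [← Int.natCast_dvd_natCast, ← act_zpow_eq_iff]
  · rw [act_zpow_comm hv, act_inj, act_zpow_eq_iff]
  · rw [← act_inj v, ← act_zpow_comm hv, act_zpow_eq_iff]

theorem minimalPeriod_neg (x : B n) (p : Pt n) :
    Function.minimalPeriod (act x) (negPt p) = Function.minimalPeriod (act x) p := by
  have h : ∀ p : Pt n,
      Function.minimalPeriod (act x) (negPt p) ∣ Function.minimalPeriod (act x) p := by
    intro p
    rw [← Int.natCast_dvd_natCast, ← act_zpow_eq_iff, act_neg]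
    exact congrArg negPt ((act_zpow_eq_iff x p _).2 dvd_rfl)
  exact Nat.dvd_antisymm (h p) (by simpa only [negPt_negPt] using h (negPt p))

theorem cycleLength_act {x v : B n} (hv : Commute v x) (p : Pt n) :
    cycleLength x (act v p) = cycleLength x p := by
  unfold cycleLength
  classical exact if_congr (isNegAt_act hv p) (by rw [minimalPeriod_act hv]) (minimalPeriod_act hv p)

theorem cycleLength_neg (x : B n) (p : Pt n) : cycleLength x (negPt p) = cycleLength x p := by
  unfold cycleLength
  classical exact if_congr (isNegAt_neg x p) (by rw [minimalPeriod_neg]) (minimalPeriod_neg x p)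

theorem isNegAt_congr {x : B n} {p q : Pt n} (h : cycleOf x p = cycleOf x q) :
    IsNegAt x p ↔ IsNegAt x q := by
  obtain ⟨m, rfl | rfl⟩ := cycleOf_eq.1 h
  · rw [isNegAt_act ((Commute.refl x).zpow_left m)]
  · rw [isNegAt_neg, isNegAt_act ((Commute.refl x).zpow_left m)]

theorem cycleLength_congr {x : B n} {p q : Pt n} (h : cycleOf x p = cycleOf x q) :
    cycleLength x p = cycleLength x q := by
  obtain ⟨m, rfl | rfl⟩ := cycleOf_eq.1 h
  · rw [cycleLength_act ((Commute.refl x).zpow_left m)]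
  · rw [cycleLength_neg, cycleLength_act ((Commute.refl x).zpow_left m)]

theorem cycleOf_act {x v : B n} (hv : Commute v x) {p q : Pt n} (h : cycleOf x p = cycleOf x q) :
    cycleOf x (act v p) = cycleOf x (act v q) := by
  obtain ⟨m, hm⟩ := cycleOf_eq.1 h
  refine cycleOf_eq.2 ⟨m, ?_⟩
  rcases hm with rfl | rfl
  · exact Or.inl (act_zpow_comm hv m p).symm
  · exact Or.inr (by rw [act_neg, act_zpow_comm hv])

theorem minimalPeriod_pos (x : B n) (p : Pt n) : 0 < Function.minimalPeriod (act x) p := by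
  refine Nat.pos_of_ne_zero fun h => ?_
  have h1 := (act_zpow_eq_iff x p (orderOf x : ℕ)).1 (by rw [zpow_natCast, pow_orderOf_eq_one]; rfl)
  rw [h, Nat.cast_zero, zero_dvd_iff] at h1
  exact (orderOf_pos x).ne' (by exact_mod_cast h1)

theorem minimalPeriod_eq_of_isNegAt {x : B n} {p : Pt n} (h : IsNegAt x p) :
    Function.minimalPeriod (act x) p = 2 * cycleLength x p := by
  rw [cycleLength, if_pos h]
  obtain ⟨m, hm⟩ := h
  have h1 : act (x ^ (2 * m)) p = p := by
    rw [two_mul, zpow_add, act_mul, ← hm, act_neg, ← hm, negPt_negPt]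
  have h2 : ¬ act (x ^ m) p = p := by
    rw [← hm]
    exact negPt_ne p
  rw [act_zpow_eq_iff] at h1 h2
  rcases Nat.even_or_odd (Function.minimalPeriod (act x) p) with he | ho
  · exact (Nat.two_mul_div_two_of_even he).symm
  · refine absurd (IsCoprime.dvd_of_dvd_mul_left ?_ h1) h2
    exact Nat.isCoprime_iff_coprime.2 (Nat.coprime_two_right.2 ho)

theorem minimalPeriod_eq_of_not_isNegAt {x : B n} {p : Pt n} (h : ¬ IsNegAt x p) :
    Function.minimalPeriod (act x) p = cycleLength x p := by
  rw [cycleLength, if_neg h]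

theorem one_le_cycleLength (x : B n) (p : Pt n) : 1 ≤ cycleLength x p := by
  have h0 := minimalPeriod_pos x p
  by_cases h : IsNegAt x p
  · rw [minimalPeriod_eq_of_isNegAt h] at h0
    omega
  · rwa [minimalPeriod_eq_of_not_isNegAt h] at h0

/-! ### The linear characters of the centralizers -/

/-- The choices that enter the definition of the linear character of the centralizer of `x`:
a base point on each signed cycle (the elements of the centralizer that permute the base points
form the wreathing groups `S_a`), and, for each `i ≥ 1`, a primitive character of the cyclic group
`ℤ_i` belonging to positive cycles of length `i` and one of the cyclic group `ℤ_{2i}` belonging to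
negative cycles of length `i`, each given by its value at the generator. -/
structure Choices (x : B n) where
  base : SCycle x → Pt n
  cycleOf_base : ∀ c, cycleOf x (base c) = c
  zetaPos : ℕ → ℂˣ
  zetaNeg : ℕ → ℂˣ
  zetaPos_primitive : ∀ i, 1 ≤ i → IsPrimitiveRoot (zetaPos i) i
  zetaNeg_primitive : ∀ i, 1 ≤ i → IsPrimitiveRoot (zetaNeg i) (2 * i)

namespace Choices

variable {x : B n} (d : Choices x)

open Classical in
/-- The value of the primitive character attached to a signed cycle at the generator `x`. -/
def root (c : SCycle x) : ℂˣ :=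
  if IsNegAt x (d.base c) then d.zetaNeg (cycleLength x (d.base c))
  else d.zetaPos (cycleLength x (d.base c))

/-- `k` is a coordinate of the point `p` on its signed cycle, with base point `b`:
`p = ± x ^ k b` on a positive cycle, `p = x ^ k b` on a negative one. -/
def IsCoord (p : Pt n) (k : ℤ) : Prop :=
  p = act (x ^ k) (d.base (cycleOf x p)) ∨
    (¬ IsNegAt x (d.base (cycleOf x p)) ∧ p = negPt (act (x ^ k) (d.base (cycleOf x p))))

theorem exists_isCoord (p : Pt n) : ∃ k, d.IsCoord p k := by
  have h := d.cycleOf_base (cycleOf x p)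
  rw [cycleOf_eq] at h
  obtain ⟨m, h | h⟩ := h
  · exact ⟨m, Or.inl h⟩
  · by_cases hn : IsNegAt x (d.base (cycleOf x p))
    · obtain ⟨l, hl⟩ := hn
      refine ⟨m + l, Or.inl ?_⟩
      rw [zpow_add, act_mul, ← hl, act_neg]
      exact h
    · exact ⟨m, Or.inr ⟨hn, h⟩⟩

/-- A coordinate of `p` (well defined modulo `i` on a positive cycle of length `i` and
modulo `2 i` on a negative one). -/
def coord (p : Pt n) : ℤ := (d.exists_isCoord p).choose

theorem coord_spec (p : Pt n) : d.IsCoord p (d.coord p) := (d.exists_isCoord p).choose_spec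

theorem root_primitive (c : SCycle x) :
    IsPrimitiveRoot (d.root c) (Function.minimalPeriod (act x) (d.base c)) := by
  unfold root
  split_ifs with h
  · rw [minimalPeriod_eq_of_isNegAt h]
    exact d.zetaNeg_primitive _ (one_le_cycleLength _ _)
  · rw [minimalPeriod_eq_of_not_isNegAt h]
    exact d.zetaPos_primitive _ (one_le_cycleLength _ _)

theorem root_zpow_eq {p : Pt n} {k l : ℤ} (hk : d.IsCoord p k) (hl : d.IsCoord p l) :
    d.root (cycleOf x p) ^ k = d.root (cycleOf x p) ^ l := by
  suffices h : act (x ^ (k - l)) (d.base (cycleOf x p)) = d.base (cycleOf x p) by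
    rw [act_zpow_eq_iff, ← (d.root_primitive _).zpow_eq_one_iff_dvd, zpow_sub,
      mul_inv_eq_one] at h
    exact h
  have key : ∀ q : Pt n, act (x ^ k) q = act (x ^ l) q → act (x ^ (k - l)) q = q := by
    intro q hq
    rw [← act_inj (x ^ l), ← act_mul, ← zpow_add, add_sub_cancel, hq]
  have key2 : ∀ (q : Pt n) (a b : ℤ), act (x ^ a) q = negPt (act (x ^ b) q) → IsNegAt x q := by
    intro q a b hq
    refine ⟨a - b, ?_⟩
    rw [← act_inj (x ^ b), ← act_mul, ← zpow_add, add_sub_cancel, hq, act_neg]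
  rcases hk with hk | ⟨hn, hk⟩ <;> rcases hl with hl | ⟨hn', hl⟩
  · exact key _ (hk.symm.trans hl)
  · exact absurd (key2 _ _ _ (hk.symm.trans hl)) hn'
  · exact absurd (key2 _ _ _ (hl.symm.trans hk)) hn
  · refine key _ ?_
    have h := congrArg negPt (hk.symm.trans hl)
    rwa [negPt_negPt, negPt_negPt] at h

theorem root_act {v : B n} (hv : Commute v x) (p : Pt n) :
    d.root (cycleOf x (act v p)) = d.root (cycleOf x p) := by
  have h1 := (isNegAt_congr (d.cycleOf_base (cycleOf x (act v p)))).trans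
    ((isNegAt_act hv p).trans (isNegAt_congr (d.cycleOf_base (cycleOf x p))).symm)
  have h2 := (cycleLength_congr (d.cycleOf_base (cycleOf x (act v p)))).trans
    ((cycleLength_act hv p).trans (cycleLength_congr (d.cycleOf_base (cycleOf x p))).symm)
  unfold root
  classical exact if_congr h1 (by rw [h2]) (by rw [h2])

/-- The factor of the linear character belonging to the signed cycle `c`. If `z` carries the base
point of `c` to the point with coordinate `k` on the signed cycle `z c`, it is the value at
`x ^ k` of the primitive character attached to `c`. -/
def factor (z : B n) (c : SCycle x) : ℂˣ := d.root c ^ d.coord (act z (d.base c))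

/-- The permutation of the signed cycles of `x` by an element of the centralizer of `x`. -/
def moveCycle (z : B n) (c : SCycle x) : SCycle x := cycleOf x (act z (d.base c))

theorem moveCycle_cycleOf {z : B n} (hz : Commute z x) (p : Pt n) :
    d.moveCycle z (cycleOf x p) = cycleOf x (act z p) :=
  cycleOf_act hz (d.cycleOf_base _)

theorem moveCycle_bijective {z : B n} (hz : Commute z x) :
    Function.Bijective (d.moveCycle z) := by
  refine Finite.injective_iff_bijective.1 fun c c' h => ?_
  have h2 := cycleOf_act hz.inv_left h
  rwa [← act_mul, ← act_mul, inv_mul_cancel, act_one, act_one, d.cycleOf_base,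
    d.cycleOf_base] at h2

theorem factor_mul {z w : B n} (hz : Commute z x) (hw : Commute w x) (c : SCycle x) :
    d.factor (z * w) c = d.factor z (d.moveCycle w c) * d.factor w c := by
  have hc : ∀ v : B n, Commute v x → d.root (cycleOf x (act v (d.base c))) = d.root c := by
    intro v hv
    rw [d.root_act hv, d.cycleOf_base]
  have hm : d.root (d.moveCycle w c) = d.root c := hc w hw
  unfold factor
  rw [hm, ← zpow_add, ← hc (z * w) (hz.mul_left hw)]
  refine d.root_zpow_eq (d.coord_spec _) ?_
  have h1 := d.coord_spec (act w (d.base c))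
  have h2 := d.coord_spec (act z (d.base (d.moveCycle w c)))
  have h3 : cycleOf x (act z (d.base (d.moveCycle w c))) = cycleOf x (act (z * w) (d.base c)) := by
    rw [act_mul]
    exact d.moveCycle_cycleOf hz _
  have hn : IsNegAt x (d.base (cycleOf x (act w (d.base c)))) ↔
      IsNegAt x (d.base (cycleOf x (act (z * w) (d.base c)))) := by
    rw [isNegAt_congr (d.cycleOf_base _), isNegAt_congr (d.cycleOf_base _), isNegAt_act hw,
      isNegAt_act (hz.mul_left hw)]
  unfold IsCoord at h1 h2 ⊢
  rw [h3] at h2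
  rw [hn] at h1
  change act w (d.base c) = act _ (d.base (d.moveCycle w c)) ∨
    (_ ∧ act w (d.base c) = negPt (act _ (d.base (d.moveCycle w c)))) at h1
  clear hn hc hm h3
  generalize d.base (cycleOf x (act (z * w) (d.base c))) = q at *
  rw [add_comm, zpow_add, act_mul, act_mul]
  rcases h1 with h1 | ⟨hn1, h1⟩ <;> rcases h2 with h2 | ⟨hn2, h2⟩
  · refine Or.inl ?_
    rw [← h2, act_zpow_comm hz, ← h1]
  · refine Or.inr ⟨hn2, ?_⟩
    rw [← act_neg, ← h2, act_zpow_comm hz, ← h1]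
  · refine Or.inr ⟨hn1, ?_⟩
    rw [← h2, act_zpow_comm hz, ← act_neg, ← h1]
  · refine Or.inl ?_
    have h3 := congrArg negPt h2
    rw [negPt_negPt] at h3
    rw [← h3, ← act_neg, act_zpow_comm hz, act_neg (x ^ _), ← h1]

theorem commute_of_mem (z : Subgroup.centralizer ({x} : Set (B n))) : Commute (z : B n) x :=
  ((Subgroup.mem_centralizer_iff.1 z.2) x rfl).symm

/-- The linear character `ω^x` of the centralizer of `x`. On each direct factor `G ≀ S_a` of the
centralizer (one for each length and sign of signed cycles, with `G = ℤ_2 × ℤ_i` or `G = ℤ_{2i}`)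
its value at an element is the product, over the `a` signed cycles, of the values of the chosen
linear character of `G` at the `G`-components; it is trivial on `S_a` and, for positive cycles,
on `ℤ_2`. -/
def omega : Subgroup.centralizer ({x} : Set (B n)) →* ℂˣ :=
  MonoidHom.mk' (fun z => ∏ c : SCycle x, d.factor z c) (by
    intro z w
    have hw := commute_of_mem w
    rw [← (d.moveCycle_bijective hw).prod_comp (fun c => d.factor z c), ← Finset.prod_mul_distrib]
    exact Finset.prod_congr rfl fun c _ => d.factor_mul (commute_of_mem z) hw c)

/-- The higher Lie character `ψ^x` of `B_n`: the character induced from `ω^x`. -/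
def psi : B n → ℂ := inducedCharacter (Subgroup.centralizer ({x} : Set (B n))) d.omega

end Choices

/-- The required choices exist for every element. -/
theorem nonempty_choices (x : B n) : Nonempty (Choices x) := by
  have h : ∀ i : ℕ, ∃ ζ : ℂˣ, 1 ≤ i → IsPrimitiveRoot ζ i := by
    intro i
    by_cases hi : 1 ≤ i
    · have h0 : i ≠ 0 := by omega
      exact ⟨((Complex.isPrimitiveRoot_exp i h0).isUnit h0).unit,
        fun _ => (Complex.isPrimitiveRoot_exp i h0).isUnit_unit h0⟩
    · exact ⟨1, fun h => absurd h hi⟩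
  choose ζ hζ using h
  have hb : ∀ c : SCycle x, ∃ p, cycleOf x p = c := fun c => Quotient.exists_rep c
  choose b hb using hb
  exact ⟨⟨b, hb, ζ, fun i => ζ (2 * i), hζ, fun i hi => hζ _ (by omega)⟩⟩

/-- A choice, for every conjugacy class `C` of `B_n`, of an element of `C` and of the data from
which the linear character of its centralizer is made. -/
structure ClassChoices (n : ℕ) where
  rep : ConjClasses (B n) → B n
  mk_rep : ∀ C, ConjClasses.mk (rep C) = C
  choices : ∀ C, Choices (rep C)

theorem nonempty_classChoices (n : ℕ) : Nonempty (ClassChoices n) := by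
  choose r hr using fun C : ConjClasses (B n) => ConjClasses.exists_rep C
  exact ⟨⟨r, hr, fun C => (nonempty_choices (r C)).some⟩⟩

/-- The higher Lie character `ψ^C` of `B_n` attached to a conjugacy class `C`. -/
def ClassChoices.psi {n : ℕ} (D : ClassChoices n) (C : ConjClasses (B n)) : B n → ℂ :=
  (D.choices C).psi

/-- The conjugacy classes `C` of `B_n` with `C ^ k = {1}`, where `C ^ k = {y ^ k : y ∈ C}`. -/
def rootClasses (n : ℕ) (k : ℤ) : Finset (ConjClasses (B n)) :=
  (Set.toFinite {C : ConjClasses (B n) | (fun y : B n => y ^ k) '' C.carrier = {1}}).toFinset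

end SignedPerm
end

noncomputable section

namespace SignedPerm

variable {n : ℕ}

/-! Once every `ω^y` is normalised to the roots of unity exp(2πi/m), inducing and summing over the
classes with C^k = {1} turns the right-hand side into the sum of ω^y(g) over all y that commute with
g and satisfy y^k = 1 (`Choices.psi_eq_sum`, `sum_rootClasses_psi`). The left-hand side counts the y
with y^k = g, and these commute with g too. So two sums over the centralizer of g are compared, and
it suffices that they agree on average over suitable families.

Group the y by the orbits of ⟨g, y, -1⟩. Within a group, multiply y by powers of g on one signed
cycle of g in each orbit; the orbits do not change. On the orbit of p, let R be the period of p
under g and y^m = ε g^σ the first return to the signed g-cycle of p. The twists keep m and ε and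
move σ through all residues modulo R. On this orbit y^k = g means k = ml, ε^l = 1, σl ≡ 1 mod R, and
y^k = 1 means the same with σl ≡ 0. Exchanging the roles of g and y on the orbit gives its
contribution to ω^y(g): if σ has order e modulo R and t inverts σ/(R/e) modulo e, it is η_e^t, where
η_e is a primitive e-th root of unity depending only on e and on signs (`IsReturn.exists_orbit`).

Everything factors over the orbits (`indicator_eq_prod`, `sum_weights`), and what remains is an
identity in ℤ/R: the sum of η_e^t over σ with lσ = 0 is the number of σ with lσ = 1
(`sum_root_pow`). It holds because σ ↦ η_e^t is a bijection onto the R-th roots of unity that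
preserves orders, and the roots ξ with ξ^l = 1 add up to 1 if l is prime to R and to 0 otherwise. -/

/-! ### Signed cycles, joint orbits and the evaluation of `ω^x` -/

theorem cycleOf_neg (x : B n) (p : Pt n) : cycleOf x (negPt p) = cycleOf x p :=
  (cycleOf_eq.2 ⟨0, Or.inr (by rw [zpow_zero, act_one])⟩).symm

theorem cycleOf_zpow (x : B n) (m : ℤ) (p : Pt n) : cycleOf x (act (x ^ m) p) = cycleOf x p :=
  (cycleOf_eq.2 ⟨m, Or.inl rfl⟩).symm

theorem cycleOf_act_iff {x v : B n} (hv : Commute v x) {p q : Pt n} :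
    cycleOf x (act v p) = cycleOf x (act v q) ↔ cycleOf x p = cycleOf x q := by
  refine ⟨fun h => ?_, cycleOf_act hv⟩
  have h2 := cycleOf_act hv.inv_left h
  rwa [← act_mul, ← act_mul, inv_mul_cancel, act_one, act_one] at h2

theorem cycleOf_zpow_mul {x z : B n} (hz : Commute z x) {p : Pt n} {a : ℤ}
    (h : cycleOf x (act (z ^ a) p) = cycleOf x p) (j : ℤ) :
    cycleOf x (act (z ^ (a * j)) p) = cycleOf x p := by
  have hpow : ∀ j : ℕ, cycleOf x (act (z ^ (a * j)) p) = cycleOf x p := by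
    intro j
    induction j with
    | zero => simp [act_one]
    | succ j ih =>
      rw [Nat.cast_succ, mul_add, mul_one, zpow_add, act_mul, ← ih,
        act_zpow_comm ((Commute.refl z).zpow_left a), ← act_mul, ← zpow_add, add_comm,
        zpow_add, act_mul]
      exact cycleOf_act (hz.zpow_left _) h
  obtain ⟨j, rfl | rfl⟩ := j.eq_nat_or_neg
  · exact hpow j
  · rw [← cycleOf_act_iff (hz.zpow_left (a * j)), ← act_mul, ← zpow_add]
    simpa [act_one] using (hpow j).symm

namespace Choices

theorem root_cycleOf {x : B n} (d : Choices x) (p : Pt n) [Decidable (IsNegAt x p)] :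
    d.root (cycleOf x p) =
      if IsNegAt x p then d.zetaNeg (cycleLength x p) else d.zetaPos (cycleLength x p) := by
  classical
  unfold root
  rw [cycleLength_congr (d.cycleOf_base (cycleOf x p))]
  exact if_congr (isNegAt_congr (d.cycleOf_base (cycleOf x p))) rfl rfl

/-- The cocycle rule `factor_mul` telescopes along the `z`-orbit of a signed cycle. -/
theorem prod_factor_moveCycle {x : B n} (d : Choices x) {z : B n} (hz : Commute z x)
    (p : Pt n) (a : ℕ) :
    ∏ j ∈ Finset.range a, d.factor z (cycleOf x (act (z ^ j) p)) =
      d.factor (z ^ a) (cycleOf x p) := by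
  induction a with
  | zero =>
    -- The cocycle rule for 1 · 1 reads f = f · f, so the factor of 1 is trivial.
    have h := d.factor_mul (Commute.one_left x) (Commute.one_left x) (cycleOf x p)
    rw [d.moveCycle_cycleOf (Commute.one_left x), act_one, mul_one] at h
    rw [Finset.prod_range_zero, pow_zero]
    exact (mul_eq_left.1 h.symm).symm
  | succ a ih =>
    rw [Finset.prod_range_succ, ih, pow_succ', d.factor_mul hz (hz.pow_left a),
      d.moveCycle_cycleOf (hz.pow_left a), mul_comm]

/-- Frees `factor` from the base point: since `v` and the negation commute with `x`, a relation v p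
= ± x^j p persists along the whole signed cycle and can be read at the base point. -/
theorem factor_eq_zpow {x : B n} (d : Choices x) {v : B n} (hv : Commute v x) {p : Pt n} {j : ℤ}
    (h : act v p = act (x ^ j) p ∨ (¬ IsNegAt x p ∧ act v p = negPt (act (x ^ j) p))) :
    d.factor v (cycleOf x p) = d.root (cycleOf x p) ^ j := by
  have hv2 : ∀ q, cycleOf x q = cycleOf x p →
      act v q = act (x ^ j) q ∨ (¬ IsNegAt x q ∧ act v q = negPt (act (x ^ j) q)) := by
    intro q hq
    obtain ⟨m, hm⟩ := cycleOf_eq.1 hq.symm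
    rw [isNegAt_congr hq]
    have hc : Commute (x ^ m) (x ^ j) := (Commute.refl x).zpow_zpow _ _
    have e : ∀ r, act (x ^ j) (act (x ^ m) r) = act (x ^ m) (act (x ^ j) r) := fun r =>
      act_zpow_comm ((Commute.refl x).zpow_left m) j r
    have e' : ∀ r, act v (act (x ^ m) r) = act (x ^ m) (act v r) := fun r =>
      (act_zpow_comm hv m r).symm
    rcases hm with rfl | rfl <;> rcases h with h | ⟨h1, h⟩
    · left; rw [e', h, e]
    · right; refine ⟨h1, ?_⟩; rw [e', h, e, act_neg]
    · left; rw [act_neg, e', h, act_neg, e]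
    · right; refine ⟨h1, ?_⟩; rw [act_neg, e', h, act_neg, act_neg, e]
  have hb := hv2 _ (d.cycleOf_base (cycleOf x p))
  have hcyc : cycleOf x (act v (d.base (cycleOf x p))) = cycleOf x p := by
    rcases hb with hb | ⟨-, hb⟩ <;> rw [hb]
    · rw [cycleOf_zpow, d.cycleOf_base]
    · rw [cycleOf_neg, cycleOf_zpow, d.cycleOf_base]
  unfold factor
  rw [← hcyc]
  refine d.root_zpow_eq ?_ ?_
  · rw [hcyc]; exact d.coord_spec _
  · unfold IsCoord
    rw [hcyc]
    exact hb

end Choices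

/-- A transversal of the orbits of the group generated by two commuting signed permutations
`x`, `z` and the negation. For the representative `pt i`, the power `z ^ per i` is the first positive
one that stabilizes the signed cycle of `x` through `pt i`, on which it acts as `± x ^ ex i`. -/
structure OrbitData (x z : B n) where
  ι : Type
  fin : Fintype ι
  pt : ι → Pt n
  per : ι → ℕ
  ex : ι → ℤ
  cover : ∀ q, ∃ i, ∃ l : ℤ, cycleOf x q = cycleOf x (act (z ^ l) (pt i))
  disj : ∀ i i' (l : ℤ), cycleOf x (act (z ^ l) (pt i)) = cycleOf x (pt i') → i = i'
  per_pos : ∀ i, 0 < per i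
  per_min : ∀ i (j : ℕ), 0 < j → j < per i → cycleOf x (act (z ^ j) (pt i)) ≠ cycleOf x (pt i)
  ex_spec : ∀ i, act (z ^ per i) (pt i) = act (x ^ ex i) (pt i) ∨
    (¬ IsNegAt x (pt i) ∧ act (z ^ per i) (pt i) = negPt (act (x ^ ex i) (pt i)))

attribute [instance] OrbitData.fin

namespace OrbitData

variable {x z : B n} (O : OrbitData x z)

theorem cycleOf_per (i : O.ι) : cycleOf x (act (z ^ O.per i) (O.pt i)) = cycleOf x (O.pt i) := by
  rcases O.ex_spec i with h | ⟨-, h⟩ <;> rw [h]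
  · rw [cycleOf_zpow]
  · rw [cycleOf_neg, cycleOf_zpow]

/-- The signed cycles of `x`, listed along the transversal. -/
def toCycle (a : Σ i : O.ι, Fin (O.per i)) : SCycle x :=
  cycleOf x (act (z ^ (a.2 : ℕ)) (O.pt a.1))

theorem toCycle_bijective (hz : Commute z x) : Function.Bijective O.toCycle := by
  constructor
  · have key : ∀ i (j j' : ℕ), j' < O.per i → j ≤ j' →
        cycleOf x (act (z ^ j) (O.pt i)) = cycleOf x (act (z ^ j') (O.pt i)) → j = j' := by
      intro i j j' hj' hle h
      by_contra hne
      have h2 : z ^ j' = z ^ j * z ^ (j' - j) := by rw [← pow_add]; congr 1; omega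
      rw [h2, act_mul, cycleOf_act_iff (hz.pow_left j)] at h
      exact O.per_min i (j' - j) (by omega) (by omega) h.symm
    rintro ⟨i, j⟩ ⟨i', j'⟩ h
    have hi : i = i' := by
      refine O.disj i i' (-(j' : ℤ) + j) ?_
      rw [zpow_add, act_mul, zpow_natCast]
      have h2 := cycleOf_act (hz.zpow_left (-(j' : ℤ))) h
      simp only at h2
      rw [h2, ← act_mul, ← zpow_natCast, ← zpow_add]
      simp [act_one]
    subst hi
    congr 1
    ext
    rcases le_total (j : ℕ) j' with hle | hle
    · exact key i j j' j'.2 hle h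
    · exact (key i j' j j.2 hle h.symm).symm
  · intro c
    obtain ⟨q, rfl⟩ : ∃ q, cycleOf x q = c := Quotient.exists_rep c
    obtain ⟨i, l, h⟩ := O.cover q
    have hpos : (0 : ℤ) < O.per i := by exact_mod_cast O.per_pos i
    have h0 := Int.emod_nonneg l hpos.ne'
    have h1 := Int.emod_lt_of_pos l hpos
    refine ⟨⟨i, (l % O.per i).toNat, by omega⟩, ?_⟩
    rw [h, toCycle, ← zpow_natCast]
    simp only [Int.toNat_of_nonneg h0]
    conv_rhs => rw [← Int.emod_add_mul_ediv l (O.per i), zpow_add, act_mul]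
    refine cycleOf_act (hz.zpow_left _) (cycleOf_zpow_mul hz ?_ _).symm
    rw [zpow_natCast]
    exact O.cycleOf_per i

/-- By telescoping, each orbit of `v` on the signed cycles contributes the factor of its return
power. No base point enters the right-hand side, so the choice of wreathing subgroups is immaterial.
-/
theorem omega_eq_prod (d : Choices x) (v : Subgroup.centralizer ({x} : Set (B n)))
    (O : OrbitData x v) :
    d.omega v = ∏ i, d.root (cycleOf x (O.pt i)) ^ O.ex i := by
  have hz := Choices.commute_of_mem v
  change ∏ c : SCycle x, d.factor v c = _
  rw [← (O.toCycle_bijective hz).prod_comp, Fintype.prod_sigma]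
  refine Finset.prod_congr rfl fun i _ => ?_
  rw [← d.factor_eq_zpow (hz.pow_left _) (O.ex_spec i), ← d.prod_factor_moveCycle hz,
    ← Fin.prod_univ_eq_prod_range (fun j => d.factor v (cycleOf x (act ((v : B n) ^ j) (O.pt i))))]
  rfl

end OrbitData

/-- The orbits of the group generated by two commuting signed permutations and the negation. -/
def jointSetoid {x z : B n} (hz : Commute z x) : Setoid (Pt n) where
  r p q := ∃ l : ℤ, cycleOf x q = cycleOf x (act (z ^ l) p)
  iseqv :=
    { refl := fun p => ⟨0, by rw [zpow_zero, act_one]⟩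
      symm := by
        rintro p q ⟨l, h⟩
        refine ⟨-l, ?_⟩
        rw [cycleOf_act (hz.zpow_left _) h, ← act_mul, ← zpow_add, neg_add_cancel, zpow_zero,
          act_one]
      trans := by
        rintro p q r ⟨l, h⟩ ⟨l', h'⟩
        refine ⟨l' + l, ?_⟩
        rw [h', zpow_add, act_mul, cycleOf_act (hz.zpow_left _) h] }

theorem exists_return {x z : B n} (p : Pt n) :
    ∃ a : ℕ, 0 < a ∧ cycleOf x (act (z ^ a) p) = cycleOf x p :=
  ⟨orderOf z, orderOf_pos z, by rw [pow_orderOf_eq_one, act_one]⟩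

/-- On a signed cycle, any two points differ by a power of `x`, and a sign in the positive case. -/
theorem exists_zpow_of_cycleOf_eq {x : B n} {p q : Pt n} (h : cycleOf x q = cycleOf x p) :
    ∃ j : ℤ, q = act (x ^ j) p ∨ (¬ IsNegAt x p ∧ q = negPt (act (x ^ j) p)) := by
  obtain ⟨m, h | h⟩ := cycleOf_eq.1 h.symm
  · exact ⟨m, Or.inl h⟩
  · by_cases hn : IsNegAt x p
    · obtain ⟨l, hl⟩ := hn
      exact ⟨m + l, Or.inl (by rw [zpow_add, act_mul, ← hl, act_neg, h])⟩
    · exact ⟨m, Or.inr ⟨hn, h⟩⟩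

open Classical in
theorem nonempty_orbitData {x z : B n} (hz : Commute z x) : Nonempty (OrbitData x z) := by
  have hJ := fun p : Pt n => exists_zpow_of_cycleOf_eq
    (Nat.find_spec (exists_return (x := x) (z := z) p)).2
  choose J hJ using hJ
  exact ⟨{
    ι := Quotient (jointSetoid hz)
    fin := Fintype.ofFinite _
    pt := Quotient.out
    per := fun i => Nat.find (exists_return (x := x) (z := z) i.out)
    ex := fun i => J i.out
    cover := fun q => ⟨Quotient.mk _ q, Quotient.mk_out (s := jointSetoid hz) q⟩
    disj := fun i i' l h => by
      rw [← Quotient.out_eq i, ← Quotient.out_eq i']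
      exact Quotient.sound ⟨l, h.symm⟩
    per_pos := fun i => (Nat.find_spec (exists_return (x := x) (z := z) i.out)).1
    per_min := fun i j h0 h1 h => Nat.find_min _ h1 ⟨h0, h⟩
    ex_spec := fun i => hJ i.out }⟩

/-! ### The standard primitive roots of unity -/

/-- The root of unity `exp (2 π i / m)`. -/
def stdRoot (m : ℕ) : ℂˣ :=
  if h : m = 0 then 1 else ((Complex.isPrimitiveRoot_exp m h).isUnit h).unit

theorem stdRoot_val {m : ℕ} (h : m ≠ 0) :
    (stdRoot m : ℂ) = Complex.exp (2 * Real.pi * Complex.I / m) := by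
  rw [stdRoot, dif_neg h, IsUnit.unit_spec]

theorem stdRoot_primitive {m : ℕ} (h : m ≠ 0) : IsPrimitiveRoot (stdRoot m) m := by
  rw [stdRoot, dif_neg h]
  exact (Complex.isPrimitiveRoot_exp m h).isUnit_unit h

theorem stdRoot_mul_pow {m e : ℕ} (hm : m ≠ 0) (he : e ≠ 0) :
    stdRoot (m * e) ^ m = stdRoot e := by
  ext
  rw [Units.val_pow_eq_pow_val, stdRoot_val (mul_ne_zero hm he), stdRoot_val he,
    ← Complex.exp_nat_mul]
  have hm' : (m : ℂ) ≠ 0 := Nat.cast_ne_zero.2 hm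
  congr 1
  push_cast
  field_simp

/-- The choices for which the primitive characters are given by the standard roots of unity. -/
def stdChoices (x : B n) : Choices x where
  base := Quotient.out
  cycleOf_base := Quotient.out_eq
  zetaPos := stdRoot
  zetaNeg := fun i => stdRoot (2 * i)
  zetaPos_primitive := fun i hi => stdRoot_primitive (by omega)
  zetaNeg_primitive := fun i hi => stdRoot_primitive (by omega)

theorem stdChoices_root (x : B n) (p : Pt n) :
    (stdChoices x).root (cycleOf x p) = stdRoot (Function.minimalPeriod (act x) p) := by
  classical
  rw [Choices.root_cycleOf]
  split_ifs with h
  · rw [minimalPeriod_eq_of_isNegAt h]; rfl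
  · rw [minimalPeriod_eq_of_not_isNegAt h]; rfl

theorem mem_centralizer_of_commute {x z : B n} (h : Commute z x) :
    z ∈ Subgroup.centralizer ({x} : Set (B n)) := by
  rw [Subgroup.mem_centralizer_singleton_iff]
  exact h.eq

/-! ### Conjugation -/

theorem act_conj_zpow (a x : B n) (m : ℤ) (p : Pt n) :
    act ((a * x * a⁻¹) ^ m) (act a p) = act a (act (x ^ m) p) := by
  rw [conj_zpow, ← act_mul, ← act_mul, inv_mul_cancel_right]

theorem cycleOf_conj (a x : B n) {p q : Pt n} :
    cycleOf (a * x * a⁻¹) (act a p) = cycleOf (a * x * a⁻¹) (act a q) ↔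
      cycleOf x p = cycleOf x q := by
  simp only [cycleOf_eq, act_conj_zpow, ← act_neg, act_inj]

theorem isNegAt_conj (a x : B n) (p : Pt n) :
    IsNegAt (a * x * a⁻¹) (act a p) ↔ IsNegAt x p := by
  simp only [IsNegAt, act_conj_zpow, ← act_neg, act_inj]

theorem minimalPeriod_eq_of_zpow {x y : B n} {p q : Pt n}
    (h : ∀ m : ℤ, act (x ^ m) p = p ↔ act (y ^ m) q = q) :
    Function.minimalPeriod (act x) p = Function.minimalPeriod (act y) q := by
  apply Nat.dvd_antisymm <;> rw [← Int.natCast_dvd_natCast, ← act_zpow_eq_iff]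
  · rw [h, act_zpow_eq_iff]
  · rw [← h, act_zpow_eq_iff]

theorem minimalPeriod_conj (a x : B n) (p : Pt n) :
    Function.minimalPeriod (act (a * x * a⁻¹)) (act a p) = Function.minimalPeriod (act x) p :=
  minimalPeriod_eq_of_zpow fun m => by rw [act_conj_zpow, act_inj]

theorem exists_act_eq (a : B n) (q : Pt n) : ∃ p, act a p = q :=
  ⟨act a⁻¹ q, by rw [← act_mul, mul_inv_cancel, act_one]⟩

/-- Transport of orbit data by conjugation. -/
def OrbitData.conj {x z : B n} (O : OrbitData x z) (a : B n) :
    OrbitData (a * x * a⁻¹) (a * z * a⁻¹) where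
  ι := O.ι
  fin := O.fin
  pt := fun i => act a (O.pt i)
  per := O.per
  ex := O.ex
  cover := by
    intro q
    obtain ⟨q, rfl⟩ := exists_act_eq a q
    simpa only [act_conj_zpow, cycleOf_conj] using O.cover q
  disj := by simpa only [act_conj_zpow, cycleOf_conj] using O.disj
  per_pos := O.per_pos
  per_min := by
    simpa only [act_conj_zpow, cycleOf_conj, ← zpow_natCast, ne_eq] using O.per_min
  ex_spec := by
    simpa only [act_conj_zpow, ← zpow_natCast, ne_eq, isNegAt_conj, ← act_neg, act_inj]
      using O.ex_spec

open Classical in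
/-- The value at `g` of the linear character of the centralizer of `y` for the standard choices
of the primitive characters, extended by zero. -/
def stdOmega (y g : B n) : ℂ :=
  if h : Commute g y then
    (((stdChoices y).omega ⟨g, mem_centralizer_of_commute h⟩ : ℂˣ) : ℂ) else 0

theorem stdOmega_eq_prod {y g : B n} (h : Commute g y) (O : OrbitData y g) :
    stdOmega y g =
      ∏ i, ((stdRoot (Function.minimalPeriod (act y) (O.pt i)) ^ O.ex i : ℂˣ) : ℂ) := by
  rw [stdOmega, dif_pos h,
    OrbitData.omega_eq_prod (stdChoices y) ⟨g, mem_centralizer_of_commute h⟩ O, Units.coe_prod]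
  simp only [stdChoices_root]

/-- Both values are products over orbit data, which conjugation transports; the unrelated base
points of the two elements do not matter. -/
theorem stdOmega_conj (a y g : B n) :
    stdOmega (a * y * a⁻¹) (a * g * a⁻¹) = stdOmega y g := by
  by_cases h : Commute g y
  · obtain ⟨O⟩ := nonempty_orbitData h
    have h2 : Commute (a * g * a⁻¹) (a * y * a⁻¹) := (Commute.conj_iff a).2 h
    rw [stdOmega_eq_prod h O, stdOmega_eq_prod h2 (O.conj a)]
    exact Finset.prod_congr rfl fun i _ => by
      change ((stdRoot (Function.minimalPeriod (act (a * y * a⁻¹)) (act a (O.pt i))) ^ O.ex i : ℂˣ)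
        : ℂ) = _
      rw [minimalPeriod_conj]
  · rw [stdOmega, stdOmega, dif_neg h, dif_neg (fun h2 => h ((Commute.conj_iff a).1 h2))]

/-- The signed permutation given by an injective odd map of points. -/
def ofInjective (f : Pt n → Pt n) (hf : Function.Injective f)
    (hneg : ∀ p, f (negPt p) = negPt (f p)) : B n :=
  ⟨Equiv.ofBijective f (Finite.injective_iff_bijective.1 hf), hneg⟩

theorem ext_act {v w : B n} (h : ∀ p, act v p = act w p) : v = w :=
  Subtype.ext (Equiv.ext h)

theorem conj_eq_conj_iff_commute {G : Type*} [Group G] {s x a b e : G} (h : s = b * x * b⁻¹) :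
    a * s * a⁻¹ = e * x * e⁻¹ ↔ b * e⁻¹ * a * s = s * (b * e⁻¹ * a) := by
  subst h
  constructor
  · intro h
    simpa [mul_assoc] using congrArg (fun t => b * e⁻¹ * t * a) h
  · intro h
    simpa [mul_assoc] using congrArg (fun t => e * b⁻¹ * t * a⁻¹) h

/-! ### Changing the primitive characters -/

/-- The signed permutation that acts as `x ^ w c` on the signed cycle `c` of `x`. -/
def twist (x : B n) (w : SCycle x → ℤ) : B n :=
  ofInjective (fun p => act (x ^ w (cycleOf x p)) p)
    (fun p q h => by
      have hc := congrArg (cycleOf x) h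
      simp only [cycleOf_zpow] at hc
      simpa only [hc, act_inj] using h)
    (fun p => by simp only [cycleOf_neg, act_neg])

theorem act_twist (x : B n) (w : SCycle x → ℤ) (p : Pt n) :
    act (twist x w) p = act (x ^ w (cycleOf x p)) p := rfl

theorem act_twist_zpow (x : B n) (w : SCycle x → ℤ) (p : Pt n) (m : ℤ) :
    act (twist x w ^ m) p = act (x ^ (w (cycleOf x p) * m)) p := by
  have hpow : ∀ (m : ℕ) p, act (twist x w ^ m) p = act (x ^ (w (cycleOf x p) * m)) p := by
    intro m
    induction m with
    | zero => simp
    | succ m ih =>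
      intro p
      rw [pow_succ, act_mul, act_twist, ih, cycleOf_zpow, ← act_mul, ← zpow_add]
      push_cast
      ring_nf
  obtain ⟨m, rfl | rfl⟩ := m.eq_nat_or_neg
  · simpa using hpow m p
  · rw [← act_inj (twist x w ^ m), ← act_mul, hpow, cycleOf_zpow, ← act_mul, ← zpow_add,
      ← zpow_natCast, ← zpow_add]
    simp

namespace Choices

variable {x : B n} (d : Choices x)

theorem root_primitive_cycleOf (p : Pt n) :
    IsPrimitiveRoot (d.root (cycleOf x p)) (Function.minimalPeriod (act x) p) := by
  classical
  rw [root_cycleOf]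
  split_ifs with h
  · rw [minimalPeriod_eq_of_isNegAt h]
    exact d.zetaNeg_primitive _ (one_le_cycleLength _ _)
  · rw [minimalPeriod_eq_of_not_isNegAt h]
    exact d.zetaPos_primitive _ (one_le_cycleLength _ _)

theorem act_zpow_coord {p q : Pt n} (hq : cycleOf x q = cycleOf x p) {k l : ℤ} (hk : d.IsCoord p k)
    (hl : d.IsCoord p l) (u : ℤ) : act (x ^ (u * k)) q = act (x ^ (u * l)) q := by
  have h := d.root_zpow_eq hk hl
  rw [← hq] at h
  rw [← mul_inv_eq_one, ← zpow_sub, (d.root_primitive_cycleOf q).zpow_eq_one_iff_dvd] at h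
  rw [← act_inj (x ^ (-(u * l))), ← act_mul, ← act_mul, ← zpow_add, ← zpow_add, neg_add_cancel,
    zpow_zero, act_one, act_zpow_eq_iff, neg_add_eq_sub, ← mul_sub]
  exact Dvd.dvd.mul_left h u

theorem IsCoord.zpow {p : Pt n} {k : ℤ} (hk : d.IsCoord p k) (j : ℤ) :
    d.IsCoord (act (x ^ j) p) (j + k) := by
  unfold IsCoord at *
  rw [cycleOf_zpow, zpow_add, act_mul, act_inj, ← act_neg, act_inj]
  exact hk

theorem exists_exponent (c : SCycle x) : ∃ u : ℤ,
    IsCoprime u (Function.minimalPeriod (act x) (d.base c) : ℤ) ∧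
      stdRoot (Function.minimalPeriod (act x) (d.base c)) = d.root c ^ u := by
  have hpos := (minimalPeriod_pos x (d.base c)).ne'
  have : NeZero (Function.minimalPeriod (act x) (d.base c)) := ⟨hpos⟩
  obtain ⟨i, -, hi, h⟩ := (IsPrimitiveRoot.coe_units_iff.2 (d.root_primitive c)).isPrimitiveRoot_iff.1
    (IsPrimitiveRoot.coe_units_iff.2 (stdRoot_primitive hpos))
  exact ⟨i, Nat.isCoprime_iff_coprime.2 hi, by ext; rw [← h, zpow_natCast, Units.val_pow_eq_pow_val]⟩

/-- Exponents that carry the chosen primitive characters to the standard ones. -/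
def expo (c : SCycle x) : ℤ := (d.exists_exponent c).choose

theorem minimalPeriod_congr {p q : Pt n} (h : cycleOf x p = cycleOf x q) :
    Function.minimalPeriod (act x) p = Function.minimalPeriod (act x) q := by
  obtain ⟨m, rfl | rfl⟩ := cycleOf_eq.1 h
  · rw [minimalPeriod_act ((Commute.refl x).zpow_left m)]
  · rw [minimalPeriod_neg, minimalPeriod_act ((Commute.refl x).zpow_left m)]

theorem expo_coprime (p : Pt n) :
    IsCoprime (d.expo (cycleOf x p)) (Function.minimalPeriod (act x) p : ℤ) := by
  rw [← minimalPeriod_congr (d.cycleOf_base (cycleOf x p))]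
  exact (d.exists_exponent _).choose_spec.1

theorem expo_spec (p : Pt n) :
    stdRoot (Function.minimalPeriod (act x) p) =
      d.root (cycleOf x p) ^ d.expo (cycleOf x p) := by
  rw [← minimalPeriod_congr (d.cycleOf_base (cycleOf x p))]
  exact (d.exists_exponent _).choose_spec.2

/-- The signed permutation obtained from `x` by replacing every cycle by a power of it, so that the
chosen primitive characters become the standard ones. -/
def std : B n := twist x d.expo

theorem act_std_zpow (p : Pt n) (m : ℤ) :
    act (d.std ^ m) p = act (x ^ (d.expo (cycleOf x p) * m)) p :=
  act_twist_zpow x _ p m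

theorem exists_act_std_zpow (p : Pt n) : ∃ v : ℤ,
    (∀ m : ℤ, act (d.std ^ (v * m)) p = act (x ^ m) p) ∧
      (∃ t : ℤ, d.expo (cycleOf x p) * v = 1 + Function.minimalPeriod (act x) p * t) := by
  obtain ⟨a, b, hab⟩ := d.expo_coprime p
  refine ⟨a, fun m => ?_, -b, by linear_combination hab⟩
  have h : d.expo (cycleOf x p) * (a * m) = m + Function.minimalPeriod (act x) p * (-b * m) := by
    linear_combination m * hab
  rw [act_std_zpow, h, zpow_add, act_mul, (act_zpow_eq_iff x p _).2 (dvd_mul_right _ _)]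

theorem cycleOf_std {p q : Pt n} :
    cycleOf d.std p = cycleOf d.std q ↔ cycleOf x p = cycleOf x q := by
  simp only [cycleOf_eq]
  constructor
  · rintro ⟨m, h⟩
    rw [act_std_zpow] at h
    exact ⟨_, h⟩
  · rintro ⟨m, h⟩
    obtain ⟨v, hv, -⟩ := d.exists_act_std_zpow p
    exact ⟨v * m, by rwa [hv]⟩

theorem isNegAt_std (p : Pt n) : IsNegAt d.std p ↔ IsNegAt x p := by
  constructor
  · rintro ⟨m, h⟩
    rw [act_std_zpow] at h
    exact ⟨_, h⟩
  · rintro ⟨m, h⟩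
    obtain ⟨v, hv, -⟩ := d.exists_act_std_zpow p
    exact ⟨v * m, by rwa [hv]⟩

theorem minimalPeriod_std (p : Pt n) :
    Function.minimalPeriod (act d.std) p = Function.minimalPeriod (act x) p :=
  minimalPeriod_eq_of_zpow fun m => by
    rw [act_std_zpow, act_zpow_eq_iff, act_zpow_eq_iff]
    exact ⟨(d.expo_coprime p).symm.dvd_of_dvd_mul_left, fun h => Dvd.dvd.mul_left h _⟩

/-- The root is constant along the orbit of a signed cycle under `z`, so the exponents at p and z p,
though chosen independently, agree modulo the period. -/
theorem commute_std {z : B n} (hz : Commute z x) : Commute z d.std := by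
  refine ext_act fun p => ?_
  have h := d.expo_spec (act z p)
  rw [minimalPeriod_act hz, d.root_act hz, d.expo_spec p, ← mul_inv_eq_one, ← zpow_sub,
    (d.root_primitive_cycleOf p).zpow_eq_one_iff_dvd, ← act_zpow_eq_iff] at h
  rw [act_mul, act_mul]
  change act z (act (x ^ d.expo (cycleOf x p)) p) =
    act (x ^ d.expo (cycleOf x (act z p))) (act z p)
  rw [act_zpow_comm hz, act_inj]
  have h2 := congrArg (act (x ^ d.expo (cycleOf x (act z p)))) h
  rwa [← act_mul, ← zpow_add, add_sub_cancel] at h2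

/-- The conjugating map from `x` to `d.std` on points. -/
def conjFun (p : Pt n) : Pt n := act (x ^ ((d.expo (cycleOf x p) - 1) * d.coord p)) p

theorem conjFun_eq {p : Pt n} {k : ℤ} (hk : d.IsCoord p k) :
    d.conjFun p = act (x ^ ((d.expo (cycleOf x p) - 1) * k)) p :=
  d.act_zpow_coord rfl (d.coord_spec p) hk _

/-- Up to sign, `conjFun` multiplies the coordinate k by the exponent u of the cycle: (u - 1)(j + k)
+ j = uj + (u - 1)k. -/
theorem conjFun_zpow (p : Pt n) (j : ℤ) :
    d.conjFun (act (x ^ j) p) = act (x ^ (d.expo (cycleOf x p) * j)) (d.conjFun p) := by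
  rw [d.conjFun_eq ((d.coord_spec p).zpow d j), cycleOf_zpow, conjFun, ← act_mul, ← act_mul,
    ← zpow_add, ← zpow_add]
  ring_nf

theorem cycleOf_conjFun (p : Pt n) : cycleOf x (d.conjFun p) = cycleOf x p := cycleOf_zpow _ _ _

theorem conjFun_neg (p : Pt n) : d.conjFun (negPt p) = negPt (d.conjFun p) := by
  by_cases hn : IsNegAt x p
  · obtain ⟨h, hh⟩ := hn
    rw [hh, conjFun_zpow, conjFun, ← act_neg, hh, ← act_mul, ← act_mul, ← zpow_add, ← zpow_add,
      ← act_inj (x ^ (-((d.expo (cycleOf x p) - 1) * d.coord p + h))), ← act_mul, ← act_mul,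
      ← zpow_add, ← zpow_add, neg_add_cancel, zpow_zero, act_one, act_zpow_eq_iff]
    have h2 : act (x ^ (h + h)) p = p := by
      rw [zpow_add, act_mul, ← hh, act_neg, ← hh, negPt_negPt]
    rw [act_zpow_eq_iff] at h2
    have hcop := d.expo_coprime p
    rw [minimalPeriod_eq_of_isNegAt ⟨h, hh⟩] at hcop h2 ⊢
    push_cast at hcop h2 ⊢
    -- Here -p = x^h p, where 2h is a multiple of the period 2i. The two sides differ by x^((u -
    -- 1)h), which is trivial at p because u, being prime to 2i, is odd.
    obtain ⟨s, hs⟩ : Odd (d.expo (cycleOf x p)) := by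
      rw [← Int.isCoprime_two_left]
      exact hcop.of_mul_right_left.symm
    rw [hs]
    refine (h2.mul_left s).trans (dvd_of_eq ?_)
    ring
  · have hk : d.IsCoord (negPt p) (d.coord p) := by
      have h := d.coord_spec p
      unfold IsCoord at *
      rw [cycleOf_neg]
      rcases h with h | ⟨-, h⟩
      · refine Or.inr ⟨?_, congrArg negPt h⟩
        rwa [isNegAt_congr (d.cycleOf_base _)]
      · refine Or.inl ?_
        conv_lhs => rw [h]
        rw [negPt_negPt]
    rw [d.conjFun_eq hk, cycleOf_neg, act_neg]
    rfl

theorem conjFun_injective : Function.Injective d.conjFun := by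
  intro p q h
  have hc := congrArg (cycleOf x) h
  rw [cycleOf_conjFun, cycleOf_conjFun] at hc
  obtain ⟨j, rfl | ⟨hn, rfl⟩⟩ := exists_zpow_of_cycleOf_eq hc.symm
  · rw [conjFun_zpow, eq_comm, act_zpow_eq_iff, minimalPeriod_congr (d.cycleOf_conjFun p)] at h
    have h2 := (d.expo_coprime p).symm.dvd_of_dvd_mul_left h
    exact ((act_zpow_eq_iff x p j).2 h2).symm
  · rw [conjFun_neg, conjFun_zpow] at h
    have h2 := congrArg negPt h
    rw [negPt_negPt] at h2
    exact absurd ((isNegAt_congr (d.cycleOf_conjFun p)).1 ⟨_, h2⟩) hn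

theorem exists_conj_std : ∃ b : B n, d.std = b * x * b⁻¹ := by
  refine ⟨ofInjective d.conjFun d.conjFun_injective d.conjFun_neg, ?_⟩
  rw [eq_mul_inv_iff_mul_eq]
  refine ext_act fun p => ?_
  rw [act_mul, act_mul]
  change act (x ^ d.expo (cycleOf x (d.conjFun p))) (d.conjFun p) = d.conjFun (act x p)
  have h := d.conjFun_zpow p 1
  rw [zpow_one, mul_one] at h
  rw [h, cycleOf_conjFun]

/-- One inclusion is `commute_std`; conjugacy of `x` and `d.std` makes the cardinalities equal. -/
theorem centralizer_std :
    Subgroup.centralizer ({x} : Set (B n)) = Subgroup.centralizer ({d.std} : Set (B n)) := by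
  refine Subgroup.eq_of_le_of_card_ge
    (fun z hz => mem_centralizer_of_commute (d.commute_std (commute_of_mem ⟨z, hz⟩))) ?_
  obtain ⟨b, hb⟩ := d.exists_conj_std
  refine Nat.card_le_card_of_injective
    (fun v : Subgroup.centralizer ({d.std} : Set (B n)) =>
      (⟨b⁻¹ * v * b, mem_centralizer_of_commute ?_⟩ : Subgroup.centralizer ({x} : Set (B n)))) ?_
  · have h : Commute (v : B n) (b * x * b⁻¹) := by
      rw [← hb]
      exact commute_of_mem v
    rw [← Commute.conj_iff b]
    simpa [mul_assoc] using h
  · intro v w h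
    have h2 := congrArg Subtype.val h
    simpa using h2

/-- Orbit data for `x` become orbit data for `d.std`. -/
def stdOrbitData {z : B n} (O : OrbitData x z) : OrbitData d.std z where
  ι := O.ι
  fin := O.fin
  pt := O.pt
  per := O.per
  ex := fun i => (d.exists_act_std_zpow (O.pt i)).choose * O.ex i
  cover := by simpa only [cycleOf_std] using O.cover
  disj := by simpa only [cycleOf_std] using O.disj
  per_pos := O.per_pos
  per_min := by simpa only [cycleOf_std, ne_eq] using O.per_min
  ex_spec := fun i => by
    rw [(d.exists_act_std_zpow (O.pt i)).choose_spec.1, isNegAt_std]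
    exact O.ex_spec i

/-- Let u be the exponent of a cycle and v its inverse modulo the period. Then x^j acts as std^(vj),
while the standard root is root^u, and root^(uvj) = root^j. -/
theorem omega_eq_stdOmega (z : Subgroup.centralizer ({x} : Set (B n))) :
    (d.omega z : ℂ) = stdOmega d.std z := by
  have hz := commute_of_mem z
  obtain ⟨O⟩ := nonempty_orbitData hz
  rw [OrbitData.omega_eq_prod d z O, stdOmega_eq_prod (d.commute_std hz) (d.stdOrbitData O),
    Units.coe_prod]
  refine Finset.prod_congr rfl fun i _ => congrArg Units.val ?_
  change _ = stdRoot (Function.minimalPeriod (act d.std) (O.pt i)) ^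
    ((d.exists_act_std_zpow (O.pt i)).choose * O.ex i)
  obtain ⟨t, ht⟩ := (d.exists_act_std_zpow (O.pt i)).choose_spec.2
  rw [minimalPeriod_std, d.expo_spec, ← zpow_mul, ← mul_assoc, ht, add_mul, one_mul, zpow_add,
    mul_assoc, zpow_mul _ (Function.minimalPeriod _ _ : ℤ), zpow_natCast,
    (d.root_primitive_cycleOf _).pow_eq_one, one_zpow, mul_one]

/-! ### Higher Lie characters as sums over conjugacy classes -/

open Classical in
-- Passing to the conjugate `d.std` absorbs the choice of primitive characters. The sum over
-- conjugators then hits each y in the class as often as the centralizer has elements, which cancels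
-- the normalising factor.
theorem psi_eq_sum (g : B n) :
    d.psi g = ∑ y : B n with IsConj x y, stdOmega y g := by
  have h1 : d.psi g = (Nat.card (Subgroup.centralizer ({x} : Set (B n))) : ℂ)⁻¹ *
      ∑ a : B n, stdOmega (a * d.std * a⁻¹) g := by
    unfold psi inducedCharacter
    congr 1
    refine Finset.sum_congr rfl fun a _ => ?_
    have h2 : stdOmega (a * d.std * a⁻¹) g = stdOmega d.std (a⁻¹ * g * a) := by
      rw [← stdOmega_conj a d.std]
      simp [mul_assoc]
    rw [h2]
    split_ifs with h
    · exact d.omega_eq_stdOmega ⟨_, h⟩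
    · rw [stdOmega, dif_neg]
      intro h3
      rw [centralizer_std] at h
      exact h (mem_centralizer_of_commute h3)
  obtain ⟨b, hb⟩ := d.exists_conj_std
  have hmaps : ∀ a ∈ (Finset.univ : Finset (B n)),
      a * d.std * a⁻¹ ∈ (Finset.univ.filter fun y : B n => IsConj x y) := by
    intro a _
    rw [Finset.mem_filter_univ, hb, isConj_iff]
    exact ⟨a * b, by group⟩
  rw [h1, ← Finset.sum_fiberwise_of_maps_to hmaps, Finset.mul_sum]
  refine Finset.sum_congr rfl fun y hy => ?_
  rw [Finset.sum_congr rfl (g := fun _ => stdOmega y g)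
    (fun a ha => by rw [(Finset.mem_filter.1 ha).2]), Finset.sum_const, nsmul_eq_mul, ← mul_assoc]
  have hcard : (Finset.univ.filter fun a : B n => a * d.std * a⁻¹ = y).card =
      Nat.card (Subgroup.centralizer ({x} : Set (B n))) := by
    rw [Finset.mem_filter_univ, isConj_iff] at hy
    obtain ⟨e, rfl⟩ := hy
    rw [d.centralizer_std, ← Nat.card_eq_finsetCard]
    refine Nat.card_congr ((Equiv.mulLeft (b * e⁻¹)).subtypeEquiv fun a => ?_)
    rw [Finset.mem_filter_univ, Subgroup.mem_centralizer_singleton_iff]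
    exact conj_eq_conj_iff_commute hb
  rw [hcard, inv_mul_cancel₀, one_mul]
  exact_mod_cast Nat.card_pos.ne'

end Choices

theorem mem_rootClasses {k : ℤ} {y : B n} :
    ConjClasses.mk y ∈ rootClasses n k ↔ y ^ k = 1 := by
  rw [rootClasses, Set.Finite.mem_toFinset]
  change (fun y : B n => y ^ k) '' (ConjClasses.mk y).carrier = {1} ↔ _
  rw [Set.eq_singleton_iff_unique_mem]
  constructor
  · intro h
    exact h.2 _ ⟨y, ConjClasses.mem_carrier_mk, rfl⟩
  · intro hy
    refine ⟨⟨y, ConjClasses.mem_carrier_mk, hy⟩, ?_⟩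
    rintro _ ⟨z, hz, rfl⟩
    rw [ConjClasses.mem_carrier_iff_mk_eq, eq_comm, ConjClasses.mk_eq_mk_iff_isConj,
      isConj_iff] at hz
    obtain ⟨c, rfl⟩ := hz
    change (c * y * c⁻¹) ^ k = 1
    rw [conj_zpow, hy, mul_one, mul_inv_cancel]

open Classical in
/-- The sum of the higher Lie characters over the classes `C` with `C ^ k = {1}`. -/
theorem sum_rootClasses_psi (k : ℤ) (D : ClassChoices n) (g : B n) :
    ∑ C ∈ rootClasses n k, D.psi C g = ∑ y : B n with y ^ k = 1, stdOmega y g := by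
  have hmaps : ∀ y ∈ (Finset.univ.filter fun y : B n => y ^ k = 1),
      ConjClasses.mk y ∈ rootClasses n k := by
    intro y hy
    rw [Finset.mem_filter_univ] at hy
    exact mem_rootClasses.2 hy
  rw [← Finset.sum_fiberwise_of_maps_to hmaps]
  refine Finset.sum_congr rfl fun C hC => ?_
  rw [ClassChoices.psi, Choices.psi_eq_sum]
  refine Finset.sum_congr ?_ fun _ _ => rfl
  ext y
  rw [Finset.mem_filter_univ, Finset.mem_filter, Finset.mem_filter_univ,
    ← ConjClasses.mk_eq_mk_iff_isConj, D.mk_rep, eq_comm, iff_and_self]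
  rintro rfl
  exact mem_rootClasses.1 hC

/-! ### Roots in a cyclic group and sums of roots of unity -/

/-- Bézout, since R / `addOrderOf x` is the gcd of R and x. -/
theorem exists_mul_eq_div_addOrderOf {R : ℕ} [NeZero R] (x : ZMod R) :
    ∃ t : ℕ, x * t = (R / addOrderOf x : ℕ) := by
  have hord : addOrderOf x = R / R.gcd x.val := by
    conv_lhs => rw [← ZMod.natCast_zmod_val x]
    exact ZMod.addOrderOf_coe _ (NeZero.ne R)
  have ha : R / addOrderOf x = R.gcd x.val := by
    rw [hord]
    exact Nat.div_div_self (Nat.gcd_dvd_left _ _) (NeZero.ne R)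
  refine ⟨((R.gcdB x.val : ℤ) : ZMod R).val, ?_⟩
  have h := congrArg (Int.cast : ℤ → ZMod R) (Nat.gcd_eq_gcd_ab R x.val)
  rw [ha, ZMod.natCast_zmod_val]
  push_cast at h
  rw [h, ZMod.natCast_self, zero_mul, zero_add, ZMod.natCast_zmod_val]

/-- An inverse of `x / a` modulo the order `e` of `x`, where `a = R / e`. -/
def unitInv {R : ℕ} [NeZero R] (x : ZMod R) : ℕ := (exists_mul_eq_div_addOrderOf x).choose

theorem unitInv_spec {R : ℕ} [NeZero R] (x : ZMod R) :
    x * unitInv x = (R / addOrderOf x : ℕ) := (exists_mul_eq_div_addOrderOf x).choose_spec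

theorem addOrderOf_dvd {R : ℕ} [NeZero R] (x : ZMod R) : addOrderOf x ∣ R := by
  simpa using addOrderOf_dvd_card (x := x)

/-- Both sides are the order of `unitInv x • x`, which is the residue R / e and so has order e. -/
theorem addOrderOf_div_gcd {R : ℕ} [NeZero R] (x : ZMod R) :
    addOrderOf x / (addOrderOf x).gcd (unitInv x) = addOrderOf x := by
  rw [← addOrderOf_nsmul, nsmul_eq_mul, mul_comm, unitInv_spec,
    ZMod.addOrderOf_coe _ (NeZero.ne R),
    Nat.gcd_eq_right (Nat.div_dvd_of_dvd (addOrderOf_dvd x)),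
    Nat.div_div_self (addOrderOf_dvd x) (NeZero.ne R)]

theorem coprime_unitInv {R : ℕ} [NeZero R] (x : ZMod R) :
    (addOrderOf x).Coprime (unitInv x) := by
  have hpos := addOrderOf_pos x
  rcases Nat.div_eq_self.1 (addOrderOf_div_gcd x) with h | h
  · omega
  · exact h

section Core

variable {R : ℕ} [NeZero R] {η : ℕ → ℂˣ}

theorem orderOf_root_pow (hη : ∀ e, e ∣ R → IsPrimitiveRoot (η e) e) (x : ZMod R) :
    orderOf (η (addOrderOf x) ^ unitInv x) = addOrderOf x :=
  ((hη _ (addOrderOf_dvd x)).pow_of_coprime _ (coprime_unitInv x).symm).eq_orderOf.symm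

/-- Equal values have the same order e, and equal exponents t modulo e, so tx = R/e = ty. Thus t and
e both kill x - y, and they are coprime. -/
theorem root_pow_injective (hη : ∀ e, e ∣ R → IsPrimitiveRoot (η e) e) :
    Function.Injective (fun x : ZMod R => η (addOrderOf x) ^ unitInv x) := by
  intro x y h
  simp only at h
  have he : addOrderOf x = addOrderOf y := by
    rw [← orderOf_root_pow hη x, h, orderOf_root_pow hη y]
  have hcop := coprime_unitInv x
  have hx := unitInv_spec x
  have hy := unitInv_spec y
  rw [← he] at h hy
  rw [← hx] at hy
  rw [pow_eq_pow_iff_modEq, ← (hη _ (addOrderOf_dvd x)).eq_orderOf] at h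
  have h2 : unitInv x • y = unitInv y • y := by
    rw [he] at h
    exact nsmul_eq_nsmul_iff_modEq.2 h
  have h3 : unitInv x • (x - y) = 0 := by
    rw [nsmul_sub, h2, nsmul_eq_mul, nsmul_eq_mul, mul_comm, mul_comm _ y, hy, sub_self]
  have h4 : addOrderOf x • (x - y) = 0 := by
    rw [nsmul_sub, addOrderOf_nsmul_eq_zero, he, addOrderOf_nsmul_eq_zero, sub_self]
  have h5 := Nat.dvd_gcd (addOrderOf_dvd_of_nsmul_eq_zero h4) (addOrderOf_dvd_of_nsmul_eq_zero h3)
  rw [hcop, Nat.dvd_one, AddMonoid.addOrderOf_eq_one_iff, sub_eq_zero] at h5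
  exact h5

/-- If l is a unit modulo R, the only solutions are 0 and the inverse of l, and both sides are 1.
Otherwise the right side is empty, and the left side becomes the sum of a nontrivial group of roots
of unity, which vanishes. -/
theorem sum_root_pow (hη : ∀ e, e ∣ R → IsPrimitiveRoot (η e) e) (l : ℤ) :
    ∑ x : ZMod R with (l : ZMod R) * x = 0, ((η (addOrderOf x) ^ unitInv x : ℂˣ) : ℂ) =
      ((Finset.univ.filter fun x : ZMod R => (l : ZMod R) * x = 1).card : ℂ) := by
  by_cases h : ∃ u : ZMod R, (l : ZMod R) * u = 1
  · obtain ⟨u, hu⟩ := h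
    have h0 : (Finset.univ.filter fun x : ZMod R => (l : ZMod R) * x = 0) = {0} := by
      ext x
      rw [Finset.mem_filter_univ, Finset.mem_singleton]
      refine ⟨fun hx => ?_, fun hx => by rw [hx, mul_zero]⟩
      linear_combination u * hx - x * hu
    have h1 : (Finset.univ.filter fun x : ZMod R => (l : ZMod R) * x = 1) = {u} := by
      ext x
      rw [Finset.mem_filter_univ, Finset.mem_singleton]
      refine ⟨fun hx => ?_, fun hx => by rw [hx, hu]⟩
      linear_combination u * hx - x * hu
    have h2 : η 1 = 1 := IsPrimitiveRoot.one_right_iff.1 (hη 1 (one_dvd _))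
    rw [h0, h1, Finset.sum_singleton, addOrderOf_zero, h2, one_pow]
    simp
  · have h1 : (Finset.univ.filter fun x : ZMod R => (l : ZMod R) * x = 1) = ∅ :=
      Finset.filter_eq_empty_iff.2 fun x _ hx => h ⟨x, hx⟩
    obtain ⟨u, hu, hu0⟩ : ∃ u : ZMod R, (l : ZMod R) * u = 0 ∧ u ≠ 0 := by
      by_contra hne
      push Not at hne
      have hinj : Function.Injective (fun x : ZMod R => (l : ZMod R) * x) := by
        intro x y hxy
        rw [← sub_eq_zero]
        refine hne _ ?_
        rw [mul_sub, sub_eq_zero]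
        exact hxy
      exact h ((Finite.injective_iff_surjective.1 hinj) 1)
    rw [h1, Finset.card_empty, Nat.cast_zero]
    have : Fintype (rootsOfUnity R ℂ) := Fintype.ofFinite _
    let f : ZMod R → rootsOfUnity R ℂ := fun x => ⟨η (addOrderOf x) ^ unitInv x, by
      rw [mem_rootsOfUnity, ← orderOf_dvd_iff_pow_eq_one, orderOf_root_pow hη]
      exact addOrderOf_dvd x⟩
    have hf : Function.Bijective f := by
      rw [Fintype.bijective_iff_injective_and_card, ZMod.card, ← Nat.card_eq_fintype_card,
        Complex.card_rootsOfUnity]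
      exact ⟨fun x y hxy => root_pow_injective hη (congrArg Subtype.val hxy), rfl⟩
    have hfl : ∀ x, f x ^ l = 1 ↔ (l : ZMod R) * x = 0 := by
      intro x
      rw [← orderOf_dvd_iff_zpow_eq_one, ← Subgroup.orderOf_coe]
      change ((orderOf (η (addOrderOf x) ^ unitInv x) : ℕ) : ℤ) ∣ l ↔ _
      rw [orderOf_root_pow hη, addOrderOf_dvd_iff_zsmul_eq_zero, zsmul_eq_mul]
    have hsum : ∑ x : ZMod R with (l : ZMod R) * x = 0,
        ((η (addOrderOf x) ^ unitInv x : ℂˣ) : ℂ) =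
        ∑ ξ : rootsOfUnity R ℂ with ξ ^ l = 1, ((ξ : ℂˣ) : ℂ) := by
      rw [Finset.sum_filter, Finset.sum_filter, ← hf.sum_comp]
      refine Finset.sum_congr rfl fun x _ => ?_
      simp only [hfl]
      rfl
    rw [hsum]
    set S := ∑ ξ : rootsOfUnity R ℂ with ξ ^ l = 1, ((ξ : ℂˣ) : ℂ) with hS
    -- `f u` is a nontrivial root with ξ^l = 1, and multiplication by it permutes the summands.
    have hmul : (((f u : rootsOfUnity R ℂ) : ℂˣ) : ℂ) * S = S := by
      rw [hS, Finset.mul_sum, Finset.sum_filter, Finset.sum_filter]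
      conv_rhs => rw [← Equiv.sum_comp (Equiv.mulLeft (f u))]
      refine Finset.sum_congr rfl fun ξ _ => ?_
      simp [mul_zpow, (hfl u).2 hu]
    have hne : (((f u : rootsOfUnity R ℂ) : ℂˣ) : ℂ) ≠ 1 := by
      intro h2
      have h3 := orderOf_root_pow hη u
      rw [show η (addOrderOf u) ^ unitInv u = 1 from Units.ext h2, orderOf_one, eq_comm,
        AddMonoid.addOrderOf_eq_one_iff] at h3
      exact hu0 h3
    by_contra hS0
    exact hne (mul_right_cancel₀ hS0 (by rw [hmul, one_mul]))

/-- The sum over a period of the integers, with an arbitrary starting point. -/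
theorem sum_range_eq_sum_zmod (f : ZMod R → ℂ) (s : ℤ) :
    ∑ j ∈ Finset.range R, f ((s + j : ℤ) : ZMod R) = ∑ x : ZMod R, f x := by
  rw [← Equiv.sum_comp (Equiv.addLeft (s : ZMod R))]
  refine Finset.sum_bij' (fun j _ => (j : ZMod R)) (fun x _ => x.val) (by simp)
    (fun x _ => by simpa using ZMod.val_lt x)
    (fun j hj => ZMod.val_cast_of_lt (Finset.mem_range.1 hj)) (by simp) (by simp)

end Core

/-- The primitive root of unity by which a cycle whose return map has order `e` modulo signs
contributes. The flag tells whether the return map or the cycle itself involves the sign. -/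
def etaRoot (flag : Prop) [Decidable flag] (e : ℕ) : ℂˣ :=
  if flag ∧ Odd e then stdRoot (2 * e) ^ (e + 1) else stdRoot e

theorem stdRoot_two_mul_pow {e : ℕ} (he : e ≠ 0) (j : ℕ) :
    stdRoot (2 * e) ^ (2 * j) = stdRoot e ^ j := by
  rw [pow_mul, stdRoot_mul_pow two_ne_zero he]

/-- For odd e the root is `stdRoot e` raised to (e + 1)/2, the inverse of 2 modulo e. -/
theorem etaRoot_primitive (flag : Prop) [Decidable flag] {e : ℕ} (he : e ≠ 0) :
    IsPrimitiveRoot (etaRoot flag e) e := by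
  unfold etaRoot
  split_ifs with h
  · obtain ⟨-, j, hj⟩ := h
    rw [show e + 1 = 2 * (j + 1) by omega, stdRoot_two_mul_pow he]
    refine (stdRoot_primitive he).pow_of_coprime _ ?_
    rw [hj, show 2 * j + 1 = (j + 1) + j by ring]
    simp
  · exact stdRoot_primitive he

/-! ### Return maps -/

/-- Multiplication by a sign. -/
def sgn (ε : ℤˣ) (p : Pt n) : Pt n := (p.1, ε * p.2)

theorem sgn_one (p : Pt n) : sgn 1 p = p := by simp [sgn]

theorem sgn_neg_one (p : Pt n) : sgn (-1) p = negPt p := by simp [sgn, negPt]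

theorem sgn_mul (δ ε : ℤˣ) (p : Pt n) : sgn (δ * ε) p = sgn δ (sgn ε p) := by
  simp [sgn, mul_assoc]

theorem act_sgn (w : B n) (ε : ℤˣ) (p : Pt n) : act w (sgn ε p) = sgn ε (act w p) := by
  rcases Int.units_eq_one_or ε with rfl | rfl
  · rw [sgn_one, sgn_one]
  · rw [sgn_neg_one, sgn_neg_one, act_neg]

theorem cycleOf_sgn (x : B n) (ε : ℤˣ) (p : Pt n) : cycleOf x (sgn ε p) = cycleOf x p := by
  rcases Int.units_eq_one_or ε with rfl | rfl
  · rw [sgn_one]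
  · rw [sgn_neg_one, cycleOf_neg]

theorem sgn_inj (ε : ℤˣ) {p q : Pt n} : sgn ε p = sgn ε q ↔ p = q := by
  refine ⟨fun h => ?_, congrArg _⟩
  have h2 := congrArg (sgn ε⁻¹) h
  rwa [← sgn_mul, ← sgn_mul, inv_mul_cancel, sgn_one, sgn_one] at h2

/-- The signs as signed permutations. -/
def signHom : ℤˣ →* B n where
  toFun ε := ofInjective (sgn ε) (fun _ _ => (sgn_inj ε).1) (fun p => by
    rw [← sgn_neg_one, ← sgn_neg_one, ← sgn_mul, ← sgn_mul, mul_comm])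
  map_one' := ext_act sgn_one
  map_mul' δ ε := ext_act (sgn_mul δ ε)

theorem act_signHom (ε : ℤˣ) (p : Pt n) : act (signHom ε) p = sgn ε p := rfl

theorem commute_signHom (ε : ℤˣ) (w : B n) : Commute (signHom ε) w :=
  ext_act fun p => by rw [act_mul, act_mul, act_signHom, act_signHom, act_sgn]

theorem act_zpow_eq_of_act_eq {u v : B n} (h : Commute u v) {p : Pt n} (hp : act u p = act v p)
    (l : ℤ) : act (u ^ l) p = act (v ^ l) p := by
  have h1 : act ((v⁻¹ * u) ^ (1 : ℤ)) p = p := by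
    rw [zpow_one, act_mul, hp, ← act_mul, inv_mul_cancel, act_one]
  have h2 : act ((v⁻¹ * u) ^ l) p = p := by
    rw [act_zpow_eq_iff] at h1 ⊢
    exact h1.trans (one_dvd l)
  rw [h.symm.inv_left.mul_zpow, act_mul] at h2
  rw [← act_inj (v⁻¹ ^ l), h2, ← act_mul, inv_zpow, inv_mul_cancel, act_one]

theorem sgn_act_zpow_eq_iff {g : B n} {p : Pt n} (hp : ¬ IsNegAt g p) (δ : ℤˣ) (i : ℤ) :
    sgn δ (act (g ^ i) p) = p ↔ δ = 1 ∧ (Function.minimalPeriod (act g) p : ℤ) ∣ i := by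
  rcases Int.units_eq_one_or δ with rfl | rfl
  · rw [sgn_one, act_zpow_eq_iff]
    simp
  · rw [sgn_neg_one]
    refine ⟨fun h => absurd ⟨i, ?_⟩ hp, fun h => absurd h.1 (by decide)⟩
    conv_lhs => rw [← h]
    rw [negPt_negPt]

/-- If -p = g^m p, the period 2i divides 2m but not m, so m is an odd multiple of i. -/
theorem act_zpow_cycleLength {g : B n} {p : Pt n} (hp : IsNegAt g p) :
    act (g ^ cycleLength g p) p = negPt p := by
  have hR := minimalPeriod_eq_of_isNegAt hp
  obtain ⟨m, hm⟩ := hp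
  have h2 : act (g ^ (m + m)) p = p := by
    rw [zpow_add, act_mul, ← hm, act_neg, ← hm, negPt_negPt]
  have h1 : ¬ act (g ^ m) p = p := by
    rw [← hm]
    exact negPt_ne p
  rw [act_zpow_eq_iff, hR] at h1 h2
  push_cast at h1 h2
  have h3 : (cycleLength g p : ℤ) ∣ m := by
    rw [← two_mul] at h2
    exact Int.dvd_of_mul_dvd_mul_left two_ne_zero h2
  obtain ⟨c, hc⟩ := h3
  obtain ⟨d, hd⟩ : Odd c := by
    rw [← Int.not_even_iff_odd]
    rintro ⟨d, rfl⟩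
    exact h1 ⟨d, by rw [hc]; ring⟩
  rw [hm, hc, hd]
  rw [show (cycleLength g p : ℤ) * (2 * d + 1) = cycleLength g p +
    Function.minimalPeriod (act g) p * d by rw [hR]; push_cast; ring, zpow_add, act_mul,
    (act_zpow_eq_iff g p _).2 (dvd_mul_right _ _), zpow_natCast]

theorem neg_act_zpow_eq_iff {g : B n} {p : Pt n} (hp : IsNegAt g p) (i : ℤ) :
    negPt (act (g ^ i) p) = p ↔
      (Function.minimalPeriod (act g) p : ℤ) ∣ i + cycleLength g p := by
  rw [← act_zpow_eq_iff, zpow_add, act_mul, zpow_natCast, act_zpow_cycleLength hp, act_neg]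

/-- `z` commutes with `g`, and `z ^ m` is the first positive power of `z` that stabilizes the signed
cycle of `g` through `p`, on which it acts as `ε g ^ σ`. -/
structure IsReturn (g z : B n) (p : Pt n) (m : ℕ) (ε : ℤˣ) (σ : ℤ) : Prop where
  comm : Commute z g
  pos : 0 < m
  eq : act (z ^ m) p = sgn ε (act (g ^ σ) p)
  dvd : ∀ j : ℤ, cycleOf g (act (z ^ j) p) = cycleOf g p → (m : ℤ) ∣ j
  sign : ε = 1 ∨ ¬ IsNegAt g p

namespace IsReturn

variable {g z : B n} {p : Pt n} {m : ℕ} {ε : ℤˣ} {σ : ℤ} (h : IsReturn g z p m ε σ)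

include h

theorem act_zpow (l : ℤ) : act (z ^ (m * l)) p = sgn (ε ^ l) (act (g ^ (σ * l)) p) := by
  have hc : Commute (z ^ m) (signHom ε * g ^ σ) :=
    ((commute_signHom ε _).symm).mul_right ((h.comm.pow_left m).zpow_right σ)
  rw [zpow_mul, zpow_natCast, act_zpow_eq_of_act_eq hc h.eq, (commute_signHom ε _).mul_zpow,
    ← map_zpow, act_mul, ← zpow_mul, act_signHom]

theorem act_eq_iff (k i : ℤ) : act (z ^ k) p = act (g ^ i) p ↔
    ∃ l, k = m * l ∧ ε ^ l = 1 ∧ (Function.minimalPeriod (act g) p : ℤ) ∣ σ * l - i := by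
  have key : ∀ l : ℤ, act (z ^ (m * l)) p = act (g ^ i) p ↔
      ε ^ l = 1 ∧ (Function.minimalPeriod (act g) p : ℤ) ∣ σ * l - i := by
    intro l
    rw [h.act_zpow, ← act_inj (g ^ (-i)), act_sgn, ← act_mul, ← act_mul, ← zpow_add, ← zpow_add,
      neg_add_cancel, zpow_zero, act_one, neg_add_eq_sub]
    rcases h.sign with rfl | hn
    · rw [one_zpow, sgn_one, act_zpow_eq_iff]
      simp
    · exact sgn_act_zpow_eq_iff hn _ _
  constructor
  · intro hk
    obtain ⟨l, rfl⟩ := h.dvd k (by rw [hk, cycleOf_zpow])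
    exact ⟨l, rfl, (key l).1 hk⟩
  · rintro ⟨l, rfl, hl⟩
    exact (key l).2 hl

theorem act_eq_self_iff (k : ℤ) : act (z ^ k) p = p ↔
    ∃ l, k = m * l ∧ ε ^ l = 1 ∧ (Function.minimalPeriod (act g) p : ℤ) ∣ σ * l := by
  have h2 := h.act_eq_iff k 0
  simpa only [zpow_zero, act_one, sub_zero] using h2

/-- Controls the first return of `g` to the signed `z`-cycle of p: up to sign, the exponent i agrees
with a multiple of σ modulo the period. -/
theorem exists_of_cycleOf_eq {i : ℤ} (hi : cycleOf z (act (g ^ i) p) = cycleOf z p) :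
    ∃ (δ : ℤˣ) (l : ℤ), sgn δ (act (g ^ (σ * l - i)) p) = p := by
  have key : ∀ (δ : ℤˣ) (j : ℤ), act (g ^ i) p = sgn δ (act (z ^ j) p) →
      ∃ (δ : ℤˣ) (l : ℤ), sgn δ (act (g ^ (σ * l - i)) p) = p := by
    intro δ j hj
    have hc := congrArg (cycleOf g) hj
    rw [cycleOf_zpow, cycleOf_sgn] at hc
    obtain ⟨l, rfl⟩ := h.dvd j hc.symm
    refine ⟨δ * ε ^ l, l, ?_⟩
    rw [← act_inj (g ^ i), hj, h.act_zpow, act_sgn, ← act_mul, ← zpow_add, add_sub_cancel, sgn_mul]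
  obtain ⟨j, hj | hj⟩ := cycleOf_eq.1 hi.symm
  · exact key 1 j (by rw [sgn_one, hj])
  · exact key (-1) j (by rw [sgn_neg_one, hj])

theorem minimalPeriod_eq {L : ℕ} (hL : ∀ l : ℤ, (ε ^ l = 1 ∧
    (Function.minimalPeriod (act g) p : ℤ) ∣ σ * l) ↔ (L : ℤ) ∣ l) :
    Function.minimalPeriod (act z) p = m * L := by
  have key : ∀ k : ℤ, ((Function.minimalPeriod (act z) p : ℕ) : ℤ) ∣ k ↔ ((m * L : ℕ) : ℤ) ∣ k := by
    intro k
    rw [← act_zpow_eq_iff, h.act_eq_self_iff]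
    simp only [hL]
    constructor
    · rintro ⟨l, rfl, c, rfl⟩
      exact ⟨c, by push_cast; ring⟩
    · rintro ⟨c, rfl⟩
      exact ⟨L * c, by push_cast; ring, dvd_mul_right _ _⟩
  apply Nat.dvd_antisymm <;> rw [← Int.natCast_dvd_natCast]
  · exact (key _).2 dvd_rfl
  · exact (key _).1 dvd_rfl

end IsReturn

/-- The arithmetic data of an integer `σ` modulo `R`: its order `e`, with `R = a e`, and an inverse
`t` of `σ / a` modulo `e`. -/
structure IsUnitInv (R : ℕ) (σ : ℤ) (a e t : ℕ) : Prop where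
  pos : 0 < R
  eq : R = a * e
  dvd_iff : ∀ l : ℤ, (R : ℤ) ∣ σ * l ↔ (e : ℤ) ∣ l
  inv : (R : ℤ) ∣ σ * t - a

namespace IsUnitInv

variable {R : ℕ} {σ : ℤ} {a e t : ℕ} (hu : IsUnitInv R σ a e t)

include hu

theorem e_pos : 0 < e := Nat.pos_of_ne_zero fun h => hu.pos.ne' (by rw [hu.eq, h, mul_zero])

theorem a_pos : 0 < a := Nat.pos_of_ne_zero fun h => hu.pos.ne' (by rw [hu.eq, h, zero_mul])

theorem a_dvd : (a : ℤ) ∣ σ := by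
  have h := (hu.dvd_iff e).2 dvd_rfl
  rw [hu.eq, Nat.cast_mul] at h
  exact Int.dvd_of_mul_dvd_mul_right (by exact_mod_cast hu.e_pos.ne') h

theorem a_dvd_R : (a : ℤ) ∣ R := ⟨e, by rw [hu.eq, Nat.cast_mul]⟩

/-- t inverts σ/a modulo e, which is even. -/
theorem odd_t (he : Even e) : Odd t := by
  obtain ⟨u, hsu⟩ := hu.a_dvd
  have h := hu.inv
  rw [hsu, hu.eq, Nat.cast_mul, show (a : ℤ) * u * t - a = a * (u * t - 1) by ring] at h
  have h2 := Int.dvd_of_mul_dvd_mul_left (by exact_mod_cast hu.a_pos.ne') h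
  obtain ⟨f, rfl⟩ := he
  obtain ⟨c, hc⟩ := h2
  rw [← Nat.not_even_iff_odd]
  rintro ⟨s, rfl⟩
  push_cast at hc
  have h3 : 2 * (u * s - f * c) = 1 := by linear_combination hc
  omega

end IsUnitInv

open Classical in
-- Exchanges the roles of `g` and `z`. At p one has z^(mt) = ε^t g^a, so `g` returns to the signed
-- `z`-cycle after a steps, with two cases in which signs interfere, both for odd e. If `g` is
-- negative at p, then -1 is not a power of `z` there and a/2 steps suffice; if ε = -1, the
-- `z`-cycle is negative and its period doubles to 2me. Both lead to the second form of `etaRoot`.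
theorem IsReturn.exists_orbit {g z : B n} {p : Pt n} {m : ℕ} {ε : ℤˣ} {σ : ℤ}
    (h : IsReturn g z p m ε σ) {a e t : ℕ}
    (hu : IsUnitInv (Function.minimalPeriod (act g) p) σ a e t) :
    ∃ (A : ℕ) (J : ℤ), 0 < A ∧
      (∀ i : ℕ, 0 < i → i < A → cycleOf z (act (g ^ i) p) ≠ cycleOf z p) ∧
      (act (g ^ A) p = act (z ^ J) p ∨
        (¬ IsNegAt z p ∧ act (g ^ A) p = negPt (act (z ^ J) p))) ∧
      stdRoot (Function.minimalPeriod (act z) p) ^ J =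
        etaRoot (ε = -1 ∨ IsNegAt g p) e ^ t := by
  have hm := h.pos.ne'
  have he0 := hu.e_pos.ne'
  have hstep : act (g ^ (σ * t)) p = act (g ^ a) p := by
    have h2 := (act_zpow_eq_iff g p _).2 hu.inv
    rw [← act_inj (g ^ a), ← act_mul, ← zpow_natCast, ← zpow_add, add_sub_cancel] at h2
    rw [h2, zpow_natCast]
  by_cases hn : IsNegAt g p
  · obtain rfl : ε = 1 := h.sign.resolve_right (fun h2 => h2 hn)
    have hper : Function.minimalPeriod (act z) p = m * e := h.minimalPeriod_eq fun l => by
      rw [one_zpow, hu.dvd_iff]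
      simp
    have hR := minimalPeriod_eq_of_isNegAt hn
    have hz : ∀ l : ℤ, act (z ^ (m * l)) p = act (g ^ (σ * l)) p := fun l => by
      rw [h.act_zpow, one_zpow, sgn_one]
    rcases Nat.even_or_odd e with he | he
    · refine ⟨a, m * t, hu.a_pos, ?_, Or.inl ?_, ?_⟩
      · intro i hi0 hia hi
        rw [← zpow_natCast] at hi
        obtain ⟨δ, l, hl⟩ := h.exists_of_cycleOf_eq hi
        have hdvd : (a : ℤ) ∣ σ * l - i := by
          rcases Int.units_eq_one_or δ with rfl | rfl
          · rw [sgn_one, act_zpow_eq_iff] at hl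
            exact hu.a_dvd_R.trans hl
          · rw [sgn_neg_one, neg_act_zpow_eq_iff hn] at hl
            -- Half the period of `g` is a(e/2), so the sign allows no earlier return.
            have h3 : (a : ℤ) ∣ cycleLength g p := by
              obtain ⟨f, rfl⟩ := he
              have h4 := hu.eq
              rw [hR] at h4
              refine ⟨f, ?_⟩
              zify at h4
              linarith
            exact (dvd_add_left h3).1 (hu.a_dvd_R.trans hl)
        have h2 : (a : ℤ) ∣ i := (dvd_sub_right (hu.a_dvd.mul_right l)).1 hdvd
        exact absurd (Nat.le_of_dvd hi0 (Int.natCast_dvd_natCast.1 h2)) (by omega)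
      · rw [hz, hstep]
      · rw [hper, zpow_mul, zpow_natCast, zpow_natCast, stdRoot_mul_pow hm he0, etaRoot,
          if_neg (fun h2 => Nat.not_even_iff_odd.2 h2.2 he)]
    · have h4 := hu.eq
      rw [hR] at h4
      obtain ⟨b, hb⟩ : Even a := by
        have h5 : Even (a * e) := h4 ▸ even_two_mul _
        rcases Nat.even_mul.1 h5 with h6 | h6
        · exact h6
        · exact absurd h6 (Nat.not_even_iff_odd.2 he)
      obtain ⟨f, hf⟩ := he
      have hlen : cycleLength g p = b * e := by
        rw [hb] at h4
        nlinarith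
      have hbR : (b : ℤ) ∣ Function.minimalPeriod (act g) p := by
        refine dvd_trans ⟨2, ?_⟩ hu.a_dvd_R
        rw [hb]; push_cast; ring
      have hbs : (b : ℤ) ∣ σ := by
        refine dvd_trans ⟨2, ?_⟩ hu.a_dvd
        rw [hb]; push_cast; ring
      -- With a = 2b and e = 2f + 1, half the period of `g` is be, and a(f + 1) = b + be; hence
      -- g^(a(f + 1)) = -g^b at p.
      refine ⟨b, m * (t * (f + 1)), by have := hu.a_pos; omega, ?_, Or.inr ⟨?_, ?_⟩, ?_⟩
      · intro i hi0 hia hi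
        rw [← zpow_natCast] at hi
        obtain ⟨δ, l, hl⟩ := h.exists_of_cycleOf_eq hi
        have hdvd : (b : ℤ) ∣ σ * l - i := by
          rcases Int.units_eq_one_or δ with rfl | rfl
          · rw [sgn_one, act_zpow_eq_iff] at hl
            exact hbR.trans hl
          · rw [sgn_neg_one, neg_act_zpow_eq_iff hn] at hl
            refine (dvd_add_left ?_).1 (hbR.trans hl)
            exact ⟨e, by rw [hlen]; push_cast; ring⟩
        have h2 : (b : ℤ) ∣ i := (dvd_sub_right (hbs.mul_right l)).1 hdvd
        exact absurd (Nat.le_of_dvd hi0 (Int.natCast_dvd_natCast.1 h2)) (by omega)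
      · rintro ⟨j, hj⟩
        have hc := congrArg (cycleOf g) hj
        rw [cycleOf_neg] at hc
        obtain ⟨l, rfl⟩ := h.dvd j hc.symm
        rw [hz] at hj
        have h6 : act (g ^ (σ * (l + l))) p = p := by
          rw [mul_add, zpow_add, act_mul, ← hj, act_neg, ← hj, negPt_negPt]
        rw [act_zpow_eq_iff, hu.dvd_iff, ← two_mul] at h6
        have h7 : (e : ℤ) ∣ l := by
          refine IsCoprime.dvd_of_dvd_mul_left ⟨1, -f, ?_⟩ h6
          rw [hf]; push_cast; ring
        rw [← hu.dvd_iff, ← act_zpow_eq_iff, ← hj] at h7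
        exact negPt_ne p h7
      · have hstep2 : act (g ^ (σ * (t * (f + 1)))) p = act (g ^ ((a : ℤ) * (f + 1))) p := by
          rw [← mul_assoc, zpow_mul g (σ * t), zpow_mul g a]
          refine act_zpow_eq_of_act_eq (((Commute.refl g).zpow_zpow _ _)) ?_ _
          rw [hstep, zpow_natCast]
        rw [hz, hstep2, show (a : ℤ) * (f + 1) = b + cycleLength g p by
          rw [hlen, hb, hf]; push_cast; ring, zpow_add, act_mul, zpow_natCast, zpow_natCast,
          act_zpow_cycleLength hn, act_neg, negPt_negPt]
      · rw [hper, zpow_mul, zpow_natCast, stdRoot_mul_pow hm he0, etaRoot,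
          if_pos ⟨Or.inr hn, f, hf⟩, show e + 1 = 2 * (f + 1) by omega, stdRoot_two_mul_pow he0,
          ← pow_mul, mul_comm (f + 1)]
        norm_cast
  · have hmin : ∀ i : ℕ, 0 < i → i < a → cycleOf z (act (g ^ i) p) ≠ cycleOf z p := by
      intro i hi0 hia hi
      rw [← zpow_natCast] at hi
      obtain ⟨δ, l, hl⟩ := h.exists_of_cycleOf_eq hi
      have hdvd : (a : ℤ) ∣ σ * l - i := hu.a_dvd_R.trans ((sgn_act_zpow_eq_iff hn _ _).1 hl).2
      have h2 : (a : ℤ) ∣ i := (dvd_sub_right (hu.a_dvd.mul_right l)).1 hdvd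
      exact absurd (Nat.le_of_dvd hi0 (Int.natCast_dvd_natCast.1 h2)) (by omega)
    rcases Int.units_eq_one_or ε with rfl | rfl
    · have hper : Function.minimalPeriod (act z) p = m * e := h.minimalPeriod_eq fun l => by
        rw [one_zpow, hu.dvd_iff]
        simp
      refine ⟨a, m * t, hu.a_pos, hmin, Or.inl ?_, ?_⟩
      · rw [h.act_zpow, one_zpow, sgn_one, hstep]
      · rw [hper, zpow_mul, zpow_natCast, zpow_natCast, stdRoot_mul_pow hm he0, etaRoot,
          if_neg]
        rintro ⟨h2 | h2, -⟩
        · exact absurd h2 (by decide)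
        · exact hn h2
    · have hsign : ∀ l : ℤ, (-1 : ℤˣ) ^ l = 1 ↔ (2 : ℤ) ∣ l := by
        intro l
        rw [← even_iff_two_dvd]
        rcases Int.even_or_odd l with hl | hl
        · simp [hl.neg_one_zpow, hl]
        · simp only [hl.neg_one_zpow, Int.not_even_iff_odd.2 hl, iff_false]
          decide
      rcases Nat.even_or_odd e with he | he
      · have hper : Function.minimalPeriod (act z) p = m * e := h.minimalPeriod_eq fun l => by
          rw [hsign, hu.dvd_iff, and_iff_right_iff_imp]
          exact fun h2 => dvd_trans (by exact_mod_cast he.two_dvd) h2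
        refine ⟨a, m * t, hu.a_pos, hmin, Or.inr ⟨?_, ?_⟩, ?_⟩
        · rintro ⟨j, hj⟩
          obtain ⟨l, rfl⟩ := h.dvd j (by rw [← hj, cycleOf_neg])
          have hj := congrArg negPt hj
          rw [negPt_negPt, h.act_zpow, ← sgn_neg_one, eq_comm, ← sgn_mul,
            sgn_act_zpow_eq_iff hn, hu.dvd_iff] at hj
          have h2 : (2 : ℤ) ∣ l := dvd_trans (by exact_mod_cast he.two_dvd) hj.2
          rw [(hsign l).2 h2] at hj
          exact absurd hj.1 (by decide)
        · have h2 : (-1 : ℤˣ) ^ (t : ℤ) = -1 := by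
            rw [zpow_natCast]
            exact (hu.odd_t he).neg_one_pow
          rw [h.act_zpow, h2, sgn_neg_one, negPt_negPt, hstep]
        · rw [hper, zpow_mul, zpow_natCast, zpow_natCast, stdRoot_mul_pow hm he0, etaRoot,
            if_neg (fun h2 => Nat.not_even_iff_odd.2 h2.2 he)]
      · have hcop : IsCoprime (2 : ℤ) e := by
          have := Nat.isCoprime_iff_coprime.2 (Nat.coprime_two_left.2 he)
          exact_mod_cast this
        have hper : Function.minimalPeriod (act z) p = m * (2 * e) :=
          h.minimalPeriod_eq fun l => by
            rw [hsign, hu.dvd_iff, Nat.cast_mul]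
            exact ⟨fun h2 => hcop.mul_dvd h2.1 h2.2,
              fun h2 => ⟨dvd_of_mul_right_dvd h2, dvd_of_mul_left_dvd h2⟩⟩
        -- The factor e + 1 is even, which removes the sign, and is 1 modulo e, which leaves g^(σt)
        -- = g^a at p.
        refine ⟨a, m * (t * (e + 1)), hu.a_pos, hmin, Or.inl ?_, ?_⟩
        · have h2 : (-1 : ℤˣ) ^ ((t : ℤ) * (e + 1)) = 1 := by
            rw [hsign]
            refine Dvd.dvd.mul_left ?_ _
            obtain ⟨f, hf⟩ := he
            exact ⟨f + 1, by rw [hf]; push_cast; ring⟩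
          have h3 : act (g ^ (σ * t * e)) p = p := by
            rw [act_zpow_eq_iff, mul_assoc, hu.dvd_iff]
            exact dvd_mul_left _ _
          rw [h.act_zpow, h2, sgn_one, show σ * (t * (e + 1) : ℤ) = σ * t + σ * t * e by ring,
            zpow_add, act_mul, h3, hstep]
        · rw [hper, zpow_mul, zpow_natCast, stdRoot_mul_pow hm (by omega), etaRoot,
            if_pos ⟨Or.inl rfl, he⟩, ← pow_mul, mul_comm (e + 1)]
          norm_cast

/-! ### Averaging over twists -/

instance instNeZeroMinimalPeriod (g : B n) (p : Pt n) :
    NeZero (Function.minimalPeriod (act g) p) := ⟨(minimalPeriod_pos g p).ne'⟩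

theorem isUnitInv_zmod {R : ℕ} [NeZero R] (σ : ℤ) :
    IsUnitInv R σ (R / addOrderOf (σ : ZMod R)) (addOrderOf (σ : ZMod R))
      (unitInv (σ : ZMod R)) where
  pos := Nat.pos_of_ne_zero (NeZero.ne R)
  eq := (Nat.div_mul_cancel (addOrderOf_dvd _)).symm
  dvd_iff l := by
    rw [← ZMod.intCast_zmod_eq_zero_iff_dvd, addOrderOf_dvd_iff_zsmul_eq_zero, zsmul_eq_mul,
      Int.cast_mul, mul_comm]
  inv := by
    rw [← ZMod.intCast_zmod_eq_zero_iff_dvd, Int.cast_sub, Int.cast_mul, Int.cast_natCast,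
      Int.cast_natCast, unitInv_spec, sub_self]

open Classical in
/-- The sum over one block: the characters of the twisted return maps add up to the number of
roots. -/
theorem sum_block {R : ℕ} [NeZero R] (k : ℤ) {m : ℕ} (hm : 0 < m) (ε : ℤˣ) (flag : Prop)
    [Decidable flag] (s : ℤ) :
    ∑ j ∈ Finset.range R,
      (if ∃ l, k = m * l ∧ ε ^ l = 1 ∧ (R : ℤ) ∣ (s + j) * l - 1 then (1 : ℂ) else 0) =
    ∑ j ∈ Finset.range R,
      (if ∃ l, k = m * l ∧ ε ^ l = 1 ∧ (R : ℤ) ∣ (s + j) * l then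
        ((etaRoot flag (addOrderOf ((s + j : ℤ) : ZMod R)) ^ unitInv ((s + j : ℤ) : ZMod R) : ℂˣ) : ℂ)
        else 0) := by
  by_cases hl : ∃ l, k = m * l ∧ ε ^ l = 1
  · obtain ⟨l, rfl, hε⟩ := hl
    -- As m > 0, k determines l, and the condition ε^l = 1 does not involve σ.
    have hex : ∀ P : ℤ → Prop, (∃ l', (m * l : ℤ) = m * l' ∧ ε ^ l' = 1 ∧ P l') ↔ P l := by
      intro P
      constructor
      · rintro ⟨l', h, -, h2⟩
        rwa [mul_left_cancel₀ (by exact_mod_cast hm.ne') h]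
      · exact fun h => ⟨l, rfl, hε, h⟩
    simp only [hex, ← ZMod.intCast_zmod_eq_zero_iff_dvd, Int.cast_sub, Int.cast_mul, Int.cast_one]
    rw [sum_range_eq_sum_zmod (fun x : ZMod R => if x * (l : ZMod R) - 1 = 0 then (1 : ℂ) else 0) s,
      sum_range_eq_sum_zmod (fun x : ZMod R => if x * (l : ZMod R) = 0 then
        ((etaRoot flag (addOrderOf x) ^ unitInv x : ℂˣ) : ℂ) else 0) s]
    have h := sum_root_pow (R := R) (η := etaRoot flag) (fun e he => etaRoot_primitive flag
      (fun h => NeZero.ne R (by rw [h, zero_dvd_iff] at he; exact he))) l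
    rw [Finset.sum_filter] at h
    simp only [mul_comm _ (l : ZMod R), sub_eq_zero]
    rw [h, Finset.sum_boole]
  · have h0 : ∀ P : ℤ → Prop, ¬ ∃ l', k = m * l' ∧ ε ^ l' = 1 ∧ P l' := by
      rintro P ⟨l', h1, h2, -⟩
      exact hl ⟨l', h1, h2⟩
    simp only [h0, if_false]

theorem exists_isReturn {g y : B n} (hy : Commute y g) (p : Pt n) :
    ∃ m ε σ, IsReturn g y p m ε σ := by
  classical
  have hex := exists_return (x := g) (z := y) p
  obtain ⟨hpos, hc⟩ := Nat.find_spec hex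
  set m := Nat.find hex with hm
  have hdvd : ∀ j : ℤ, cycleOf g (act (y ^ j) p) = cycleOf g p → (m : ℤ) ∣ j := by
    intro j hj
    have hpos' : (0 : ℤ) < m := by exact_mod_cast hpos
    have h0 := Int.emod_nonneg j hpos'.ne'
    have h1 := Int.emod_lt_of_pos j hpos'
    rw [← Int.emod_add_mul_ediv j m, zpow_add, act_mul] at hj
    have h2 : cycleOf g (act (y ^ ((m : ℤ) * (j / m))) p) = cycleOf g p :=
      cycleOf_zpow_mul hy (by rwa [zpow_natCast]) _
    rw [cycleOf_act (hy.zpow_left _) h2] at hj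
    rw [Int.dvd_iff_emod_eq_zero]
    by_contra hne
    refine Nat.find_min hex (m := (j % m).toNat) (by omega) ⟨by omega, ?_⟩
    rw [← zpow_natCast, Int.toNat_of_nonneg h0]
    exact hj
  obtain ⟨σ, h | ⟨hn, h⟩⟩ := exists_zpow_of_cycleOf_eq hc
  · exact ⟨m, 1, σ, hy, hpos, by rw [sgn_one, h], hdvd, Or.inl rfl⟩
  · exact ⟨m, -1, σ, hy, hpos, by rw [sgn_neg_one, h], hdvd, Or.inr hn⟩

/-- Commuting signed permutations that permute the signed cycles of `g` in the same way. -/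
theorem cycleOf_zpow_congr {g y z : B n} (hy : Commute y g)
    (h : ∀ q, cycleOf g (act z q) = cycleOf g (act y q)) (j : ℤ) (q : Pt n) :
    cycleOf g (act (z ^ j) q) = cycleOf g (act (y ^ j) q) := by
  have hpow : ∀ (j : ℕ) q, cycleOf g (act (z ^ j) q) = cycleOf g (act (y ^ j) q) := by
    intro j
    induction j with
    | zero => simp
    | succ j ih =>
      intro q
      rw [pow_succ', pow_succ', act_mul, act_mul, h]
      exact cycleOf_act hy (ih q)
  obtain ⟨j, rfl | rfl⟩ := j.eq_nat_or_neg
  · simpa using hpow j q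
  · have h2 := hpow j (act (z ^ (-(j : ℤ))) q)
    rw [← act_mul, ← zpow_natCast, ← zpow_add, add_neg_cancel, zpow_zero, act_one] at h2
    rw [← cycleOf_act_iff (hy.zpow_left j), ← act_mul (y ^ (j : ℤ)) (y ^ (-(j : ℤ))), ← zpow_add,
      add_neg_cancel, zpow_zero, act_one, h2, zpow_natCast]

/-- Joint orbits are symmetric in the two elements. Read through the signed cycles of `g`, they are
visibly unchanged when `y` is multiplied by a twist of `g`. -/
theorem jointSetoid_iff {g y : B n} (hy : Commute g y) (p q : Pt n) :
    jointSetoid hy p q ↔ ∃ m : ℤ, cycleOf g p = cycleOf g (act (y ^ m) q) := by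
  change (∃ l : ℤ, cycleOf y q = cycleOf y (act (g ^ l) p)) ↔ _
  constructor
  · rintro ⟨l, h⟩
    obtain ⟨m, h | h⟩ := cycleOf_eq.1 h
    · exact ⟨m, by rw [← h, cycleOf_zpow]⟩
    · refine ⟨m, ?_⟩
      have h2 := congrArg (cycleOf g) h
      rwa [cycleOf_neg, cycleOf_zpow] at h2
  · rintro ⟨m, h⟩
    obtain ⟨l, h | h⟩ := cycleOf_eq.1 h
    · exact ⟨l, by rw [← h, cycleOf_zpow]⟩
    · refine ⟨l, ?_⟩
      have h2 := congrArg (cycleOf y) h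
      rwa [cycleOf_neg, cycleOf_zpow] at h2

theorem jointSetoid_congr {g y z : B n} (hy : Commute g y) (hz : Commute g z)
    (h : ∀ q, cycleOf g (act z q) = cycleOf g (act y q)) : jointSetoid hz = jointSetoid hy := by
  ext p q
  simp only [jointSetoid_iff, cycleOf_zpow_congr hy.symm h]

theorem commute_twist (g : B n) (w : SCycle g → ℤ) : Commute g (twist g w) := by
  refine ext_act fun p => ?_
  have hc : cycleOf g (act g p) = cycleOf g p := by simpa using cycleOf_zpow g 1 p
  rw [act_mul, act_mul, act_twist, act_twist, hc, act_zpow_comm (Commute.refl g)]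

theorem cycleOf_act_twist (g : B n) (w : SCycle g → ℤ) (q : Pt n) :
    cycleOf g (act (twist g w) q) = cycleOf g q := by
  rw [act_twist, cycleOf_zpow]

theorem cycleOf_mul_twist {g y : B n} (hy : Commute y g) (w : SCycle g → ℤ) (q : Pt n) :
    cycleOf g (act (y * twist g w) q) = cycleOf g (act y q) := by
  rw [act_mul]
  exact cycleOf_act hy (cycleOf_act_twist g w q)

/-- Twisting on the signed cycle of the base point only changes the return map by a power
of `g`. -/
theorem IsReturn.mul_twist {g y : B n} {p : Pt n} {m : ℕ} {ε : ℤˣ} {σ : ℤ}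
    (h : IsReturn g y p m ε σ) (w : SCycle g → ℤ)
    (hw : ∀ q, jointSetoid h.comm.symm p q → cycleOf g q ≠ cycleOf g p → w (cycleOf g q) = 0) :
    IsReturn g (y * twist g w) p m ε (σ + w (cycleOf g p)) where
  comm := h.comm.mul_left (commute_twist g w).symm
  pos := h.pos
  eq := by
    have hpow : ∀ j : ℕ, j < m → act ((y * twist g w) ^ (j + 1)) p =
        act (g ^ w (cycleOf g p)) (act (y ^ (j + 1)) p) := by
      intro j
      induction j with
      | zero =>
        intro _
        rw [zero_add, pow_one, pow_one, act_mul, act_twist, act_zpow_comm h.comm]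
      | succ j ih =>
        intro hj
        -- Strictly before time m the orbit of p avoids its own signed `g`-cycle, so the twist
        -- contributes only at the first step.
        have h0 : w (cycleOf g (act (y ^ (j + 1)) p)) = 0 := by
          refine hw _ ((jointSetoid_iff _ _ _).2 ⟨-((j + 1 : ℕ) : ℤ), ?_⟩) fun hc => ?_
          · rw [← act_mul, ← zpow_natCast, ← zpow_add, neg_add_cancel, zpow_zero, act_one]
          · rw [← zpow_natCast] at hc
            have h2 := Nat.le_of_dvd (by omega) (Int.natCast_dvd_natCast.1 (h.dvd _ hc))
            omega
        rw [pow_succ', act_mul, ih (by omega), act_mul, act_twist, cycleOf_zpow, h0, zpow_zero,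
          act_one, ← act_zpow_comm h.comm, ← act_mul y, ← pow_succ']
    have h1 := hpow (m - 1) (by have := h.pos; omega)
    rw [Nat.sub_add_cancel h.pos] at h1
    rw [h1, h.eq, act_sgn, ← act_mul, ← zpow_add, add_comm]
  dvd j hj := h.dvd j (by
    rwa [cycleOf_zpow_congr h.comm (cycleOf_mul_twist h.comm w)] at hj)
  sign := h.sign

/-- The exponents of a twist that is supported on one signed cycle of `g` in each class of `s`. -/
def blockWeight (g : B n) (s : Setoid (Pt n)) (w : Quotient s → ℕ) (c : SCycle g) : ℤ :=
  open Classical in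
  if c = cycleOf g (Quotient.mk s (Quotient.out c)).out then w (Quotient.mk s (Quotient.out c)) else 0

theorem mk_out_cycleOf {g y : B n} (hy : Commute g y) {b : Quotient (jointSetoid hy)} {q : Pt n}
    (hq : jointSetoid hy b.out q) :
    Quotient.mk (jointSetoid hy) (Quotient.out (cycleOf g q)) = b := by
  rw [← Quotient.out_eq b]
  refine Quotient.sound (Setoid.symm' _ ?_)
  obtain ⟨m, hm⟩ := (jointSetoid_iff _ _ _).1 hq
  refine (jointSetoid_iff _ _ _).2 ⟨m, ?_⟩
  rw [hm]
  have h : cycleOf g (Quotient.out (cycleOf g q)) = cycleOf g q := Quotient.out_eq _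
  exact (cycleOf_act (hy.symm.zpow_left m) h).symm

theorem blockWeight_out {g y : B n} (hy : Commute g y) (w : Quotient (jointSetoid hy) → ℕ)
    (b : Quotient (jointSetoid hy)) :
    blockWeight g (jointSetoid hy) w (cycleOf g b.out) = w b := by
  rw [blockWeight, mk_out_cycleOf hy (Setoid.refl' _ _), if_pos rfl]

theorem blockWeight_eq_zero {g y : B n} (hy : Commute g y) (w : Quotient (jointSetoid hy) → ℕ)
    (b : Quotient (jointSetoid hy)) {q : Pt n} (hq : jointSetoid hy b.out q)
    (hc : cycleOf g q ≠ cycleOf g b.out) :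
    blockWeight g (jointSetoid hy) w (cycleOf g q) = 0 := by
  rw [blockWeight, mk_out_cycleOf hy hq, if_neg hc]

/-- Equality of commuting elements of the centralizer can be tested on a transversal. -/
theorem eq_iff_forall_out {g z u v : B n} (hz : Commute g z) (hug : Commute g u)
    (huz : Commute z u) (hvg : Commute g v) (hvz : Commute z v) :
    u = v ↔ ∀ b : Quotient (jointSetoid hz), act u b.out = act v b.out := by
  refine ⟨fun h b => by rw [h], fun h => ext_act fun q => ?_⟩
  obtain ⟨l, hl⟩ : jointSetoid hz (Quotient.mk (jointSetoid hz) q).out q := Quotient.mk_out q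
  have hb := h (Quotient.mk (jointSetoid hz) q)
  obtain ⟨m, hm | hm⟩ := cycleOf_eq.1 hl.symm
  · rw [hm, ← act_zpow_comm huz.symm, ← act_zpow_comm hug.symm, hb, act_zpow_comm hvg.symm,
      act_zpow_comm hvz.symm]
  · rw [hm, act_neg, act_neg, ← act_zpow_comm huz.symm, ← act_zpow_comm hug.symm, hb,
      act_zpow_comm hvg.symm, act_zpow_comm hvz.symm]

/-! ### Factorization over the joint orbits -/

instance instFintypeQuotientPt (s : Setoid (Pt n)) : Fintype (Quotient s) := Fintype.ofFinite _

open Classical in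
-- The hypotheses describe `z` on the signed cycles of `g`, whereas ω^z(g) needs `g` on those of
-- `z`; `IsReturn.exists_orbit` converts between them at the same representatives.
theorem stdOmega_eq_prod_out {g z : B n} (hz : Commute g z)
    {m : Quotient (jointSetoid hz) → ℕ} {ε : Quotient (jointSetoid hz) → ℤˣ}
    {σ : Quotient (jointSetoid hz) → ℤ} (h : ∀ b, IsReturn g z b.out (m b) (ε b) (σ b)) :
    stdOmega z g = ∏ b : Quotient (jointSetoid hz),
      ((etaRoot (ε b = -1 ∨ IsNegAt g b.out)
        (addOrderOf (σ b : ZMod (Function.minimalPeriod (act g) b.out))) ^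
        unitInv (σ b : ZMod (Function.minimalPeriod (act g) b.out)) : ℂˣ) : ℂ) := by
  choose A J hA hmin hJ hval using fun b => (h b).exists_orbit (isUnitInv_zmod (σ b))
  let O : OrbitData z g :=
    { ι := Quotient (jointSetoid hz)
      fin := inferInstance
      pt := Quotient.out
      per := A
      ex := J
      cover := fun q => ⟨Quotient.mk _ q, Quotient.mk_out (s := jointSetoid hz) q⟩
      disj := fun i i' l h => by
        rw [← Quotient.out_eq i, ← Quotient.out_eq i']
        exact Quotient.sound ⟨l, h.symm⟩
      per_pos := hA
      per_min := hmin
      ex_spec := hJ }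
  rw [stdOmega_eq_prod hz O]
  exact Finset.prod_congr rfl fun b _ => congrArg Units.val (hval b)

open Classical in
/-- The indicator of a `k`-th root of `g`, and the character value at `g` for a `k`-th root of `1`,
as products over the joint orbits. -/
theorem indicator_eq_prod (k : ℤ) {g z : B n} (hz : Commute g z) {s : Setoid (Pt n)}
    (hs : jointSetoid hz = s) {m : Quotient s → ℕ} {ε : Quotient s → ℤˣ} {σ : Quotient s → ℤ}
    (h : ∀ b, IsReturn g z b.out (m b) (ε b) (σ b)) :
    ((if z ^ k = g then (1 : ℂ) else 0) = ∏ b : Quotient s,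
      (if ∃ l, k = m b * l ∧ ε b ^ l = 1 ∧
        (Function.minimalPeriod (act g) b.out : ℤ) ∣ σ b * l - 1 then (1 : ℂ) else 0)) ∧
    ((if z ^ k = 1 then stdOmega z g else 0) = ∏ b : Quotient s,
      (if ∃ l, k = m b * l ∧ ε b ^ l = 1 ∧
        (Function.minimalPeriod (act g) b.out : ℤ) ∣ σ b * l then
        ((etaRoot (ε b = -1 ∨ IsNegAt g b.out)
          (addOrderOf (σ b : ZMod (Function.minimalPeriod (act g) b.out))) ^
          unitInv (σ b : ZMod (Function.minimalPeriod (act g) b.out)) : ℂˣ) : ℂ) else 0)) := by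
  subst hs
  have hzk : Commute z (z ^ k) := (Commute.refl z).zpow_right k
  constructor
  · rw [Finset.prod_boole]
    simp only [Finset.mem_univ, forall_true_left]
    refine if_congr ?_ rfl rfl
    rw [eq_iff_forall_out hz (hz.zpow_right k) hzk (Commute.refl g) hz.symm]
    refine ⟨fun h2 b => ?_, fun h2 b => ?_⟩
    · exact ((h b).act_eq_iff k 1).1 (by rw [h2 b, zpow_one])
    · have h3 := ((h b).act_eq_iff k 1).2 (h2 b)
      rwa [zpow_one] at h3
  · have hiff : z ^ k = 1 ↔ ∀ b : Quotient (jointSetoid hz), ∃ l, k = m b * l ∧ ε b ^ l = 1 ∧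
        (Function.minimalPeriod (act g) b.out : ℤ) ∣ σ b * l := by
      rw [eq_iff_forall_out hz (hz.zpow_right k) hzk (Commute.one_right g) (Commute.one_right z)]
      exact forall_congr' fun b => by rw [act_one, (h b).act_eq_self_iff]
    by_cases hk : z ^ k = 1
    · rw [if_pos hk, stdOmega_eq_prod_out hz h]
      exact Finset.prod_congr rfl fun b _ => (if_pos (hiff.1 hk b)).symm
    · rw [if_neg hk]
      rw [hiff] at hk
      push Not at hk
      obtain ⟨b, hb⟩ := hk
      refine (Finset.prod_eq_zero (Finset.mem_univ b) (if_neg ?_)).symm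
      rintro ⟨l, h1, h2, h3⟩
      exact hb l h1 h2 h3

/-- The exponents of the twists for the classes of `s`. -/
def weights (g : B n) (s : Setoid (Pt n)) : Finset (Quotient s → ℕ) :=
  open Classical in
  Fintype.piFinset fun b => Finset.range (Function.minimalPeriod (act g) b.out)

theorem card_weights_ne_zero (g : B n) (s : Setoid (Pt n)) : (weights g s).card ≠ 0 := by
  classical
  rw [weights, Fintype.card_piFinset, Finset.prod_ne_zero_iff]
  intro b _
  rw [Finset.card_range]
  exact (minimalPeriod_pos g _).ne'

open Classical in
-- The weight w replaces σ b by σ b + w b and keeps the orbits, m and ε. The sum over all w of a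
-- product over orbits is therefore a product of sums, and `sum_block` compares them factor by
-- factor.
theorem sum_weights (k : ℤ) {g y : B n} (hy : Commute g y) {s : Setoid (Pt n)}
    (hs : jointSetoid hy = s) :
    ∑ w ∈ weights g s, (if (y * twist g (blockWeight g s w)) ^ k = g then (1 : ℂ) else 0) =
      ∑ w ∈ weights g s, (if (y * twist g (blockWeight g s w)) ^ k = 1 then
        stdOmega (y * twist g (blockWeight g s w)) g else 0) := by
  subst hs
  choose m ε σ h using fun b : Quotient (jointSetoid hy) => exists_isReturn hy.symm b.out
  have hz : ∀ w, Commute g (y * twist g (blockWeight g (jointSetoid hy) w)) := fun w =>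
    hy.mul_right (commute_twist g _)
  have hret : ∀ (w : Quotient (jointSetoid hy) → ℕ) (b : Quotient (jointSetoid hy)),
      IsReturn g (y * twist g (blockWeight g (jointSetoid hy) w)) b.out (m b) (ε b)
        (σ b + w b) := by
    intro w b
    have h2 := (h b).mul_twist (blockWeight g (jointSetoid hy) w)
      (fun q hq hc => blockWeight_eq_zero hy w b hq hc)
    rwa [blockWeight_out] at h2
  have hs : ∀ w, jointSetoid (hz w) = jointSetoid hy := fun w =>
    jointSetoid_congr hy (hz w) (cycleOf_mul_twist hy.symm _)
  rw [Finset.sum_congr rfl fun w _ => (indicator_eq_prod k (hz w) (hs w) (hret w)).1,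
    Finset.sum_congr rfl fun w _ => (indicator_eq_prod k (hz w) (hs w) (hret w)).2, weights]
  refine (Finset.prod_univ_sum _ (fun (b : Quotient (jointSetoid hy)) (j : ℕ) =>
    if ∃ l, k = m b * l ∧ ε b ^ l = 1 ∧
        (Function.minimalPeriod (act g) b.out : ℤ) ∣ (σ b + j) * l - 1 then (1 : ℂ) else 0)).symm.trans
    (Eq.trans ?_ (Finset.prod_univ_sum _ (fun (b : Quotient (jointSetoid hy)) (j : ℕ) =>
      if ∃ l, k = m b * l ∧ ε b ^ l = 1 ∧
        (Function.minimalPeriod (act g) b.out : ℤ) ∣ (σ b + j) * l then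
        ((etaRoot (ε b = -1 ∨ IsNegAt g b.out)
          (addOrderOf ((σ b + j : ℤ) : ZMod (Function.minimalPeriod (act g) b.out))) ^
          unitInv ((σ b + j : ℤ) : ZMod (Function.minimalPeriod (act g) b.out)) : ℂˣ) : ℂ) else 0)))
  exact Finset.prod_congr rfl fun b _ => sum_block k (h b).pos (ε b) _ (σ b)

/-! ### Partition of the centralizer of `g` by joint orbits -/

open Classical in
/-- The elements of the centralizer of `g` with given joint orbits. -/
def orbitFiber (g : B n) (s : Setoid (Pt n)) : Finset (B n) :=
  Finset.univ.filter fun y => ∃ hy : Commute g y, jointSetoid hy = s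

open Classical in
theorem sum_orbitFiber_mul_twist {g : B n} {s : Setoid (Pt n)} (w : SCycle g → ℤ) (f : B n → ℂ) :
    ∑ y ∈ orbitFiber g s, f (y * twist g w) = ∑ y ∈ orbitFiber g s, f y := by
  refine Finset.sum_equiv (Equiv.mulRight (twist g w)) (fun y => ?_) (fun y _ => rfl)
  rw [orbitFiber, Finset.mem_filter_univ, Finset.mem_filter_univ, Equiv.coe_mulRight]
  constructor
  · rintro ⟨hy, hs⟩
    refine ⟨hy.mul_right (commute_twist g w), ?_⟩
    rw [← hs]
    exact jointSetoid_congr hy _ (cycleOf_mul_twist hy.symm w)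
  · rintro ⟨hy, hs⟩
    have hy2 : Commute g y := by
      simpa using hy.mul_right (commute_twist g w).inv_right
    refine ⟨hy2, ?_⟩
    rw [← hs]
    exact (jointSetoid_congr hy2 hy (cycleOf_mul_twist hy2.symm w)).symm

/-- The twists depend only on `g` and the partition, not on y, and right multiplication by each of
them permutes the fiber. -/
theorem sum_orbitFiber_mul_card {g : B n} {s : Setoid (Pt n)} (f : B n → ℂ) :
    ((weights g s).card : ℂ) * ∑ y ∈ orbitFiber g s, f y =
      ∑ y ∈ orbitFiber g s, ∑ w ∈ weights g s, f (y * twist g (blockWeight g s w)) := by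
  rw [Finset.sum_comm, Finset.sum_congr rfl fun w _ => sum_orbitFiber_mul_twist _ f,
    Finset.sum_const, nsmul_eq_mul]

open Classical in
theorem sum_orbitFiber_eq (k : ℤ) (g : B n) (s : Setoid (Pt n)) :
    ∑ y ∈ orbitFiber g s, (if y ^ k = g then (1 : ℂ) else 0) =
      ∑ y ∈ orbitFiber g s, (if y ^ k = 1 then stdOmega y g else 0) := by
  refine mul_left_cancel₀ (Nat.cast_ne_zero.2 (card_weights_ne_zero g s) : _ ≠ (0 : ℂ)) ?_
  rw [sum_orbitFiber_mul_card (fun y => if y ^ k = g then (1 : ℂ) else 0),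
    sum_orbitFiber_mul_card (fun y => if y ^ k = 1 then stdOmega y g else 0)]
  refine Finset.sum_congr rfl fun y hy => ?_
  rw [orbitFiber, Finset.mem_filter_univ] at hy
  obtain ⟨hy, hs⟩ := hy
  exact sum_weights k hy hs

open Classical in
-- Elements that do not commute with `g` receive ⊤ as a default; this does no harm because `f`
-- vanishes on them.
theorem sum_eq_sum_orbitFiber (g : B n) (f : B n → ℂ) (hf : ∀ y, ¬ Commute g y → f y = 0) :
    ∑ y, f y = ∑ s ∈ Finset.univ.image (fun y : B n =>
      if hy : Commute g y then jointSetoid hy else ⊤), ∑ y ∈ orbitFiber g s, f y := by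
  rw [← Finset.sum_fiberwise_of_maps_to (fun y _ => Finset.mem_image_of_mem (fun y : B n =>
    if hy : Commute g y then jointSetoid hy else ⊤) (Finset.mem_univ y))]
  refine Finset.sum_congr rfl fun s _ => (Finset.sum_subset ?_ ?_).symm
  · intro y hy
    rw [orbitFiber, Finset.mem_filter_univ] at hy
    obtain ⟨hy, hs⟩ := hy
    rw [Finset.mem_filter_univ, dif_pos hy, hs]
  · intro y hy hy2
    refine hf y fun hc => hy2 ?_
    rw [Finset.mem_filter_univ, dif_pos hc] at hy
    rw [orbitFiber, Finset.mem_filter_univ]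
    exact ⟨hc, hy⟩

end SignedPerm

end

theorem theoremt (n : ℕ) (k : ℤ) (D : SignedPerm.ClassChoices n) (g : SignedPerm.B n) :
    (rootEnum k g : ℂ) = ∑ C ∈ SignedPerm.rootClasses n k, D.psi C g := by
  classical
  have h1 : (rootEnum k g : ℂ) = ∑ y : SignedPerm.B n, (if y ^ k = g then (1 : ℂ) else 0) := by
    rw [Finset.sum_boole, rootEnum, Nat.card_eq_fintype_card, Fintype.card_subtype]
  rw [h1, SignedPerm.sum_rootClasses_psi, Finset.sum_filter,
    SignedPerm.sum_eq_sum_orbitFiber g, SignedPerm.sum_eq_sum_orbitFiber g]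
  · exact Finset.sum_congr rfl fun s _ => by
      convert SignedPerm.sum_orbitFiber_eq k g s
  · intro y hy
    rw [SignedPerm.stdOmega, dif_neg hy, ite_self]
  · intro y hy
    refine if_neg fun h => hy ?_
    rw [← h]
    exact ((Commute.refl y).zpow_right k).symm
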